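/- Let $n\ge 1$. Let $\mathcal{C}l_n$ be the real Clifford algebra generated by $e_1,\dots,e_n$ with $e_ie_j+e_je_i=-2\delta_{ij}$, with basis $e_A$ ($A\subseteq\{1,\dots,n\}$) and norm $\|\sum_A x_Ae_A\|^2=\sum_A x_A^2$. Write $x_0,\dots,x_n$ for the coordinates of $\mathbb{R}^{n+1}$, let $\mathbb{S}^n\subset\mathbb{R}^{n+1}$ be the unit sphere, and for $w\in\mathbb{S}^n$ write $w=w_0+\sum_{j=1}^n w_je_j$ and $\overline{w}=w_0-\sum_{j=1}^n w_je_j$, acting by left multiplication. On $\mathcal{C}l_n$-valued functions on $\mathbb{S}^n$ consider the tangential operators $$\Gamma_0=\sum_{j=1}^n e_j(x_0\partial_{x_j}-x_j\partial_{x_0})-\sum_{1\le i<j\le n}e_ie_j(x_i\partial_{x_j}-x_j\partial_{x_i}),$$ $$\overline{\Gamma_0}=-\sum_{j=1}^n e_j(x_0\partial_{x_j}-x_j\partial_{x_0})-\sum_{1\le i<j\le n}e_ie_j(x_i\partial_{x_j}-x_j\partial_{x_i}),$$ the spherical Dirac operators $D_s=w(\Gamma_0-\frac n2)$ and $\overline{D_s}=\overline{w}(\overline{\Gamma_0}-\frac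 n2)$, and the conformally invariant spherical Laplacian $\Delta_s=\Delta_{\mathbb{S}^n}-\frac{n(n-2)}4$, where $\Delta_{\mathbb{S}^n}$ is the Laplace–Beltrami operator of the round sphere. Let $H_m$ be the space of restrictions to $\mathbb{S}^n$ of $\mathcal{C}l_n$-valued harmonic polynomials on $\mathbb{R}^{n+1}$ that are homogeneous of degree $m$. Then: 1. On $C^2$ functions $\mathbb{S}^n\to\mathcal{C}l_n$, $$\Delta_s=\overline{D_s}(D_s+w)=D_s(\overline{D_s}+\overline{w})=-\Gamma_0^2+(n-1)\Gamma_0-\Big(\frac{n^2}4-\frac n2\Big)=-\overline{\Gamma_0}^2+(n-1)\overline{\Gamma_0}-\Big(\frac{n^2}4-\frac n2\Big).$$ 2. For every $m\ge 0$, the elements of $H_m$ are smooth and $$\Delta_s h=\Big(-m^2-m(n-1)-\Big(\frac{n^2}4-\frac n2\Big)\Big)h\qquad(h\in H_m).$$ 3. As an unbounded operator on $L^2(\mathbb{S}^n,\mathcal{C}l_n)$ (surface measure) with domain $C^\infty(\mathbb{S}^n,\mathcal{C}l_n)$, $\Delta_s$ is closable, and the spectrum of its closure (the set of $z\in\mathbb{C}$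 for which closure minus $z$, on the complexification of $L^2$, has no bounded everywhere defined two-sided inverse) is $$\sigma(\Delta_s)=\Big\{-m^2-m(n-1)-\Big(\frac{n^2}4-\frac n2\Big):m=0,1,2,\dots\Big\}.$$ -/

import Mathlib

open scoped Manifold ContDiff

noncomputable section

namespace SphericalClifford

/-! ### The Clifford algebra `Cl_n` -/

/-- The negative definite form `x ↦ -(x₁² + ⋯ + xₙ²)` on `ℝⁿ`. -/
abbrev negSq (n : ℕ) : QuadraticForm ℝ (Fin n → ℝ) :=
  QuadraticMap.weightedSumSquares ℝ (fun _ : Fin n => (-1 : ℝ))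

/-- The real Clifford algebra `Cl_n`, in which `x² = -‖x‖²` for `x ∈ ℝⁿ`. -/
abbrev Cl (n : ℕ) : Type := CliffordAlgebra (negSq n)

/-- The generators `e₁, …, eₙ` (indexed from `0`). -/
def gen {n : ℕ} (i : Fin n) : Cl n := CliffordAlgebra.ι (negSq n) (Pi.single i 1)

/-- The linear basis `(e_A)` of `Cl_n`, indexed by the subsets `A` of `{1, …, n}`; see
`clBasis_apply` for the identification of `e_A` with the ordered product of the `e_i`, `i ∈ A`. -/
def clBasis (n : ℕ) : Module.Basis (Finset (Fin n)) ℝ (Cl n) :=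
  (Pi.basisFun ℝ (Fin n)).ExteriorAlgebra.map (CliffordAlgebra.equivExterior (negSq n)).symm

lemma clBasis_apply_aux {n : ℕ} (l : List (Fin n)) (hl : l.Nodup) :
    CliffordAlgebra.equivExterior (negSq n) (l.map gen).prod =
      (l.map fun i => ExteriorAlgebra.ι ℝ (Pi.single i (1 : ℝ) : Fin n → ℝ)).prod := by
  have contr : ∀ (d : Module.Dual ℝ (Fin n → ℝ)) (l : List (Fin n)),
      (∀ j ∈ l, d (Pi.single j 1) = 0) →
      CliffordAlgebra.contractLeft (Q := (0 : QuadraticForm ℝ (Fin n → ℝ))) d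
        (l.map fun i => CliffordAlgebra.ι (0 : QuadraticForm ℝ (Fin n → ℝ))
          (Pi.single i (1 : ℝ))).prod = 0 := by
    intro d l
    induction l with
    | nil => intro _; simp
    | cons a t ih =>
      intro h
      rw [List.map_cons, List.prod_cons, CliffordAlgebra.contractLeft_ι_mul,
        ih (fun j hj => h j (List.mem_cons_of_mem _ hj)), h a List.mem_cons_self]
      simp
  induction l with
  | nil => simp [CliffordAlgebra.equivExterior, CliffordAlgebra.changeFormEquiv]
  | cons a t ih =>
    have hat := (List.nodup_cons.1 hl).1
    have ih' := ih (List.nodup_cons.1 hl).2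
    simp only [CliffordAlgebra.equivExterior, CliffordAlgebra.changeFormEquiv_apply] at ih' ⊢
    rw [List.map_cons, List.prod_cons, List.map_cons, List.prod_cons, gen,
      CliffordAlgebra.changeForm_ι_mul, ih']
    have := contr ((QuadraticMap.associated (R := ℝ) (-(negSq n))) (Pi.single a 1)) t (by
      intro j hj
      have hne : a ≠ j := fun h => hat (h ▸ hj)
      have hsum : ∀ v : Fin n → ℝ, (negSq n) v = - ∑ i, v i * v i := by
        intro v; simp [negSq, QuadraticMap.weightedSumSquares_apply]
      rw [QuadraticMap.associated_apply]
      simp only [neg_apply, hsum, Pi.add_apply, add_mul, mul_add,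
        Finset.sum_add_distrib]
      have h1 : ∀ a b : Fin n, a ≠ b →
          ∑ i, (Pi.single a (1 : ℝ) : Fin n → ℝ) i * (Pi.single b (1 : ℝ) : Fin n → ℝ) i = 0 := by
        intro a b hab
        apply Finset.sum_eq_zero
        intro i _
        by_cases hi : i = a
        · subst hi; simp [Pi.single_eq_of_ne hab]
        · simp [Pi.single_eq_of_ne hi]
      rw [h1 a j hne, h1 j a hne.symm]
      simp)
    have h2 := this
    erw [h2]
    rw [sub_zero]

/-- `e_A` is the product of the generators `e_i`, `i ∈ A`, in increasing order. -/
theorem clBasis_apply {n : ℕ} (A : Finset (Fin n)) :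
    clBasis n A = ((A.sort (· ≤ ·)).map gen).prod := by
  rw [clBasis, Module.Basis.map_apply, LinearEquiv.symm_apply_eq,
    clBasis_apply_aux _ (A.sort_nodup _), ExteriorAlgebra.basis_apply_ofCard _ rfl]
  change ExteriorAlgebra.ιMulti ℝ A.card (_ ∘ _) = _
  rw [ExteriorAlgebra.ιMulti_apply]
  congr 1
  apply List.ext_getElem
  · simp
  · intro i h1 h2
    simp [Set.powersetCard.ofFinEmbEquiv_symm_apply, Finset.orderEmbOfFin_apply]

/-- The inner product `⟨x, y⟩ = ∑_A x_A y_A` on `Cl_n`. -/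
@[reducible]
def clCore (n : ℕ) : InnerProductSpace.Core ℝ (Cl n) where
  inner x y := ∑ A, (clBasis n).repr x A * (clBasis n).repr y A
  conj_inner_symm x y := by simp [mul_comm]
  re_inner_nonneg x := by
    simpa using Finset.sum_nonneg fun A _ => mul_self_nonneg ((clBasis n).repr x A)
  add_left x y z := by simp [add_mul, Finset.sum_add_distrib]
  smul_left x y r := by simp [mul_assoc, Finset.mul_sum]
  definite x h := by
    have h' := (Finset.sum_eq_zero_iff_of_nonneg
      (fun A _ => mul_self_nonneg ((clBasis n).repr x A))).1 h
    apply (clBasis n).repr.injective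
    ext A
    simpa using h' A (Finset.mem_univ A)

/-- The norm `‖x‖² = ∑_A x_A²` on `Cl_n`. -/
instance instNormCl (n : ℕ) : NormedAddCommGroup (Cl n) :=
  (clCore n).toNormedAddCommGroup

instance instInnerCl (n : ℕ) : InnerProductSpace ℝ (Cl n) :=
  InnerProductSpace.ofCore (clCore n).toCore

/-! ### The sphere, and differential operators on it -/

/-- The Euclidean space `ℝ^{n+1}`, with coordinates `x₀, x₁, …, xₙ`. -/
abbrev Euc (n : ℕ) : Type := EuclideanSpace ℝ (Fin (n + 1))

/-- The unit sphere `Sⁿ ⊂ ℝ^{n+1}`. -/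
abbrev Sph (n : ℕ) : Type := Metric.sphere (0 : Euc n) 1

/-- The paravector `x₀ + x₁ e₁ + ⋯ + xₙ eₙ`. -/
def para {n : ℕ} (x : Euc n) : Cl n :=
  algebraMap ℝ (Cl n) (x 0) + ∑ j : Fin n, x j.succ • gen j

/-- The conjugate paravector `x₀ - x₁ e₁ - ⋯ - xₙ eₙ`. -/
def paraBar {n : ℕ} (x : Euc n) : Cl n :=
  algebraMap ℝ (Cl n) (x 0) - ∑ j : Fin n, x j.succ • gen j

/-- The partial derivative `∂F/∂x_i`. -/
def pd {n : ℕ} (i : Fin (n + 1)) (F : Euc n → Cl n) (x : Euc n) : Cl n :=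
  fderiv ℝ F x (EuclideanSpace.single i 1)

/-- The angular derivative `x_i ∂_j F - x_j ∂_i F`. -/
def ang {n : ℕ} (i j : Fin (n + 1)) (F : Euc n → Cl n) (x : Euc n) : Cl n :=
  x i • pd j F x - x j • pd i F x

/-- `∑_{1 ≤ i < j ≤ n} e_i e_j (x_i ∂_j - x_j ∂_i)`. -/
def angBivector {n : ℕ} (F : Euc n → Cl n) (x : Euc n) : Cl n :=
  ∑ i : Fin n, ∑ j ∈ Finset.univ.filter (fun j : Fin n => i < j),
    gen i * gen j * ang i.succ j.succ F x

/-- `Γ₀ = ∑_j e_j (x₀ ∂_j - x_j ∂₀) - ∑_{i<j} e_i e_j (x_i ∂_j - x_j ∂_i)` on `ℝ^{n+1}`. -/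
def gammaEuc {n : ℕ} (F : Euc n → Cl n) (x : Euc n) : Cl n :=
  (∑ j : Fin n, gen j * ang 0 j.succ F x) - angBivector F x

/-- `Γ̄₀ = -∑_j e_j (x₀ ∂_j - x_j ∂₀) - ∑_{i<j} e_i e_j (x_i ∂_j - x_j ∂_i)` on `ℝ^{n+1}`. -/
def gammaBarEuc {n : ℕ} (F : Euc n → Cl n) (x : Euc n) : Cl n :=
  -(∑ j : Fin n, gen j * ang 0 j.succ F x) - angBivector F x

/-- The extension `x ↦ f (x / ‖x‖)` of a function on the sphere, homogeneous of degree `0`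
(with the value `0` at the origin). -/
def radialExt {n : ℕ} (f : Sph n → Cl n) (x : Euc n) : Cl n :=
  if hx : x ≠ 0 then f ⟨‖x‖⁻¹ • x, by simp [norm_smul, hx]⟩ else 0

/-- `Γ₀` on functions on the sphere. The fields `x_i ∂_j - x_j ∂_i` are tangent to the sphere, so
that the choice of the extension does not matter. -/
def gammaS {n : ℕ} (f : Sph n → Cl n) : Sph n → Cl n := fun w => gammaEuc (radialExt f) w

/-- `Γ̄₀` on functions on the sphere. -/
def gammaBarS {n : ℕ} (f : Sph n → Cl n) : Sph n → Cl n := fun w => gammaBarEuc (radialExt f) w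

/-- Left multiplication by the variable `w ∈ Sⁿ`. -/
def mulW {n : ℕ} (f : Sph n → Cl n) : Sph n → Cl n := fun w => para (w : Euc n) * f w

/-- Left multiplication by `w̄`. -/
def mulWBar {n : ℕ} (f : Sph n → Cl n) : Sph n → Cl n := fun w => paraBar (w : Euc n) * f w

/-- The conformally invariant spherical Dirac operator `D_s = w (Γ₀ - n/2)`. -/
def diracS {n : ℕ} (f : Sph n → Cl n) : Sph n → Cl n := mulW (gammaS f - ((n : ℝ) / 2) • f)

/-- The conjugate spherical Dirac operator `D̄_s = w̄ (Γ̄₀ - n/2)`. -/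
def diracBarS {n : ℕ} (f : Sph n → Cl n) : Sph n → Cl n :=
  mulWBar (gammaBarS f - ((n : ℝ) / 2) • f)

/-- The Laplace–Beltrami operator of the round sphere: the restriction to the sphere of the
Euclidean Laplacian of the extension that is homogeneous of degree `0`. -/
def beltramiS {n : ℕ} (f : Sph n → Cl n) : Sph n → Cl n :=
  fun w => Laplacian.laplacian (radialExt f) (w : Euc n)

/-- The conformally invariant spherical Laplacian `Δ_s = Δ_{Sⁿ} - n(n-2)/4`, with `Δ_{Sⁿ}` the
Laplace–Beltrami operator. -/
def laplaceS {n : ℕ} (f : Sph n → Cl n) : Sph n → Cl n :=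
  beltramiS f - ((n : ℝ) * ((n : ℝ) - 2) / 4) • f

/-- `H_m`: the restrictions to `Sⁿ` of the `Cl_n`-valued polynomials `∑_A P_A e_A` that are
homogeneous of degree `m` and harmonic. -/
def sphHarm (n m : ℕ) : Set (Sph n → Cl n) :=
  {h | ∃ P : Finset (Fin n) → MvPolynomial (Fin (n + 1)) ℝ,
    (∀ A, (P A).IsHomogeneous m) ∧
    (∀ A, ∑ i, MvPolynomial.pderiv i (MvPolynomial.pderiv i (P A)) = 0) ∧
    ∀ w : Sph n, h w =
      ∑ A, MvPolynomial.eval (fun i => (w : Euc n) i) (P A) • clBasis n A}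

/-! ### `Δ_s` as an unbounded operator on `L²(Sⁿ, Cl_n)` -/

instance instFactFinrank (n : ℕ) : Fact (Module.finrank ℝ (Euc n) = n + 1) :=
  ⟨finrank_euclideanSpace_fin⟩

/-- `L²(Sⁿ, Cl_n)` with respect to the surface measure. -/
abbrev L2S (n : ℕ) : Type :=
  MeasureTheory.Lp (Cl n) 2 (MeasureTheory.volume : MeasureTheory.Measure (Euc n)).toSphere

/-- The space `C^∞(Sⁿ, Cl_n)`. -/
abbrev SmoothS (n : ℕ) : Type := ContMDiffMap (𝓡 n) 𝓘(ℝ, Cl n) (Sph n) (Cl n) ∞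

lemma contDiffAt_radialExt {n : ℕ} {k : ℕ∞} {f : Sph n → Cl n}
    (hf : ContMDiff (𝓡 n) 𝓘(ℝ, Cl n) k f) {x : Euc n} (hx : x ≠ 0) :
    ContDiffAt ℝ k (radialExt f) x := by
  have hx' : 0 < ‖x‖ := norm_pos_iff.2 hx
  let χ : ContDiffBump x := ⟨‖x‖ / 4, ‖x‖ / 2, by positivity, by linarith⟩
  let p : Euc n → Euc n := fun y => x + χ y • (y - x)
  have hp : ContDiff ℝ k p :=
    contDiff_const.add ((χ.contDiff).smul (contDiff_id.sub contDiff_const))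
  have hp0 : ∀ y, p y ≠ 0 := by
    intro y h
    have h1 : ‖χ y • (y - x)‖ < ‖x‖ := by
      by_cases hy : dist y x < ‖x‖ / 2
      · rw [norm_smul, Real.norm_of_nonneg χ.nonneg, ← dist_eq_norm]
        calc χ y * dist y x ≤ 1 * dist y x := by gcongr; exact χ.le_one
          _ < ‖x‖ := by linarith
      · have : χ y = 0 := χ.zero_of_le_dist (not_lt.1 hy)
        rw [this]; simpa using hx
    have h2 : χ y • (y - x) = -x := by
      rw [eq_neg_iff_add_eq_zero, add_comm]; exact h
    rw [h2, norm_neg] at h1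
    exact lt_irrefl _ h1
  have hq : ContDiff ℝ k fun y => ‖p y‖⁻¹ • p y :=
    ((hp.norm ℝ hp0).inv fun y => norm_ne_zero_iff.2 (hp0 y)).smul hp
  have hq1 : ∀ y, ‖p y‖⁻¹ • p y ∈ Metric.sphere (0 : Euc n) 1 := fun y => by
    simp [norm_smul, hp0 y]
  have hc := hf.comp (hq.contMDiff.codRestrict_sphere (n := n) hq1)
  have hc' := (contMDiff_iff_contDiff.1 hc).contDiffAt (x := x)
  refine hc'.congr_of_eventuallyEq ?_
  filter_upwards [χ.eventuallyEq_one] with y hy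
  have hpy : p y = y := by simp [p, hy]
  have hy0 : y ≠ 0 := hpy ▸ hp0 y
  simp only [radialExt, dif_pos hy0, Function.comp_apply]
  congr 1
  apply Subtype.ext
  simp [hpy]

lemma sph_ne_zero {n : ℕ} (w : Sph n) : (w : Euc n) ≠ 0 := ne_zero_of_mem_unit_sphere w

lemma continuous_laplaceS {n : ℕ} {f : Sph n → Cl n}
    (hf : ContMDiff (𝓡 n) 𝓘(ℝ, Cl n) 2 f) : Continuous (laplaceS f) := by
  refine Continuous.sub ?_ (hf.continuous.const_smul _)
  rw [continuous_iff_continuousAt]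
  intro w
  have h := (contDiffAt_radialExt (k := 2) hf (sph_ne_zero w)).iteratedFDeriv_right
    (i := 2) (m := 0) (by norm_num)
  have h2 : ContinuousAt (Laplacian.laplacian (radialExt f)) (w : Euc n) := by
    rw [InnerProductSpace.laplacian_eq_iteratedFDeriv_stdOrthonormalBasis]
    refine tendsto_finsetSum _ fun i _ => ?_
    exact ((ContinuousMultilinearMap.apply ℝ (fun _ : Fin 2 => Euc n) (Cl n) _).continuous.continuousAt).comp
      h.continuousAt
  exact h2.comp continuous_subtype_val.continuousAt

lemma laplaceS_add {n : ℕ} {f g : Sph n → Cl n} (hf : ContMDiff (𝓡 n) 𝓘(ℝ, Cl n) 2 f)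
    (hg : ContMDiff (𝓡 n) 𝓘(ℝ, Cl n) 2 g) : laplaceS (f + g) = laplaceS f + laplaceS g := by
  have h : radialExt (f + g) = radialExt f + radialExt g := by
    funext x
    by_cases hx : x = 0 <;> simp [radialExt, hx]
  funext w
  have := (contDiffAt_radialExt (k := 2) hf (sph_ne_zero w)).laplacian_add
    (contDiffAt_radialExt (k := 2) hg (sph_ne_zero w))
  simp only [laplaceS, beltramiS, h, Pi.add_apply, Pi.sub_apply, Pi.smul_apply, smul_add] at this ⊢
  rw [this]
  abel

lemma laplaceS_smul {n : ℕ} (r : ℝ) {f : Sph n → Cl n} (hf : ContMDiff (𝓡 n) 𝓘(ℝ, Cl n) 2 f) :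
    laplaceS (r • f) = r • laplaceS f := by
  have h : radialExt (r • f) = r • radialExt f := by
    funext x
    by_cases hx : x = 0 <;> simp [radialExt, hx]
  funext w
  have := InnerProductSpace.laplacian_smul r
    (contDiffAt_radialExt (k := 2) hf (sph_ne_zero w))
  simp only [laplaceS, beltramiS, h, Pi.sub_apply, Pi.smul_apply, smul_sub] at this ⊢
  rw [this, smul_comm r]

lemma SmoothS.contMDiff_two {n : ℕ} (f : SmoothS n) : ContMDiff (𝓡 n) 𝓘(ℝ, Cl n) 2 f :=
  f.contMDiff.of_le (by
    have h : ((2 : ℕ∞) : ℕ∞ω) ≤ ((⊤ : ℕ∞) : ℕ∞ω) := WithTop.coe_le_coe.2 le_top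
    exact h)

/-- The inclusion of the continuous functions in `L²(Sⁿ, Cl_n)`. -/
def contToL2 (n : ℕ) : C(Sph n, Cl n) →ₗ[ℝ] L2S n :=
  (ContinuousMap.toLp (E := Cl n) 2
    (MeasureTheory.volume : MeasureTheory.Measure (Euc n)).toSphere ℝ).toLinearMap

/-- The inclusion of the smooth functions in the continuous functions. -/
def smoothToCont (n : ℕ) : SmoothS n →ₗ[ℝ] C(Sph n, Cl n) where
  toFun f := ⟨f, f.contMDiff.continuous⟩
  map_add' _ _ := rfl
  map_smul' _ _ := rfl

/-- The inclusion of `C^∞(Sⁿ, Cl_n)` in `L²(Sⁿ, Cl_n)`. -/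
def smoothToL2 (n : ℕ) : SmoothS n →ₗ[ℝ] L2S n := contToL2 n ∘ₗ smoothToCont n

lemma smoothToL2_injective (n : ℕ) : Function.Injective (smoothToL2 n) := by
  intro f g h
  have h1 : smoothToCont n f = smoothToCont n g :=
    ContinuousMap.toLp_injective (E := Cl n) (𝕜 := ℝ) (p := 2)
      (MeasureTheory.volume : MeasureTheory.Measure (Euc n)).toSphere h
  exact DFunLike.ext _ _ fun x => DFunLike.congr_fun h1 x

/-- `Δ_s` as a map from the smooth to the continuous functions. -/
def laplaceToCont (n : ℕ) : SmoothS n →ₗ[ℝ] C(Sph n, Cl n) where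
  toFun f := ⟨laplaceS f, continuous_laplaceS f.contMDiff_two⟩
  map_add' f g := ContinuousMap.ext fun w =>
    congrFun (laplaceS_add f.contMDiff_two g.contMDiff_two) w
  map_smul' r f := ContinuousMap.ext fun w => congrFun (laplaceS_smul r f.contMDiff_two) w

/-- `Δ_s` as an unbounded operator on `L²(Sⁿ, Cl_n)` with domain `C^∞(Sⁿ, Cl_n)`. -/
def laplacePMap (n : ℕ) : L2S n →ₗ.[ℝ] L2S n where
  domain := LinearMap.range (smoothToL2 n)
  toFun := contToL2 n ∘ₗ laplaceToCont n ∘ₗ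
    (LinearEquiv.ofInjective (smoothToL2 n) (smoothToL2_injective n)).symm.toLinearMap

/-! ### The spectrum of an unbounded operator -/

/-- The resolvent set of an unbounded operator `A` on a real Banach space `H`: the `z ∈ ℂ` for which
`A - z` has a bounded everywhere defined two-sided inverse `R`. Here `A` acts on the
complexification of `H`, whose element `u + iv` is written as the pair `(u, v)`, so that
`(A - z)(u + iv) = (A u - Re z u + Im z v) + i (A v - Re z v - Im z u)`. -/
def resolventSetC {H : Type*} [NormedAddCommGroup H] [NormedSpace ℝ H] (A : H →ₗ.[ℝ] H) : Set ℂ :=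
  {z | ∃ R : (H × H) →L[ℝ] (H × H),
    (∀ u v : A.domain,
      R (A u - z.re • (u : H) + z.im • (v : H), A v - z.re • (v : H) - z.im • (u : H)) =
        ((u : H), (v : H))) ∧
    ∀ p : H × H, ∃ u v : A.domain, R p = ((u : H), (v : H)) ∧
      (A u - z.re • (u : H) + z.im • (v : H), A v - z.re • (v : H) - z.im • (u : H)) = p}

/-- The spectrum of an unbounded operator on a real Banach space, as a subset of `ℂ`. -/
def spectrumC {H : Type*} [NormedAddCommGroup H] [NormedSpace ℝ H] (A : H →ₗ.[ℝ] H) : Set ℂ :=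
  (resolventSetC A)ᶜ

end SphericalClifford

end

open SphericalClifford

noncomputable section

namespace SphericalClifford

/-! ### Calculus of partial derivatives -/

section Calculus

variable {n : ℕ}

/-! Put `u = (1, e₁, …, eₙ)` and let `v` be the conjugate family. The single relation `u_a v_b + u_b
v_a = 2δ_ab` yields `x x̄ = |x|²` and `∂∂̄ = Δ` for `∂ = ∑ u_a ∂_a`, and also `∂(x̄G) = (n+1)G + 2EG
- x ∂̄G` with `E` the Euler operator. Moreover `Γ₀ = x̄∂ - E`, and `Γ̄₀` arises by exchanging `u`
and `v`, so each identity is proved once for an abstract conjugate pair and used twice.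

Let `F` be the degree 0 extension of `f`. Then `EF = 0` and `∂F` has degree `-1`, so `Γf = x̄∂F` and
the commutation rule gives `Γ² = (n-1)Γ - Δ_S` (`gamS_gamS`). The quadratic formulas follow. The
factorizations come from `Γ̄₀ w = w(n - Γ₀)` together with `w̄w = 1` (`laplace_eq_dirac_mul`).

If `P` is homogeneous of degree `m`, its restriction extends as `|x|^{-m} P`, whence `(Δ_s -
λ_m)(P|_S) = (ΔP)|_S` (`laplaceS_polyFun`). Harmonic polynomials therefore give eigenfunctions.
Since the right side has lower degree, induction on `m` places every polynomial in the span of the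
eigenspaces, and Stone–Weierstrass makes this span dense in `L²`.

Green's identity on the sphere (`integral_inner_beltramiS`) shows that `Δ_s` is symmetric. An
operator that is symmetric against a total sequence of eigenspaces, with distinct eigenvalues
tending to `-∞`, is closable, and off the eigenvalues the resolvent of its closure is the diagonal
operator with entries `1/(λ_k - z)` (`spectrumC_closure_of_eigenspaces`). Each `λ_m` does occur,
through `Re (x₀ + i xₙ)^m`. -/

instance instFiniteDimensionalCl (n : ℕ) : FiniteDimensional ℝ (Cl n) :=
  (clBasis n).finiteDimensional_of_finite

/-- The multiplication of `Cl_n` as a continuous bilinear map. -/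
def mulCL (n : ℕ) : Cl n →L[ℝ] Cl n →L[ℝ] Cl n :=
  (LinearMap.mul ℝ (Cl n)).toContinuousBilinearMap

lemma mulCL_apply (a b : Cl n) : mulCL n a b = a * b := rfl

lemma _root_.DifferentiableAt.cl_mul {A F : Euc n → Cl n} {x : Euc n}
    (hA : DifferentiableAt ℝ A x) (hF : DifferentiableAt ℝ F x) :
    DifferentiableAt ℝ (fun y => A y * F y) x :=
  ((mulCL n).hasFDerivAt_of_bilinear hA.hasFDerivAt hF.hasFDerivAt).differentiableAt

lemma pd_mul {A F : Euc n → Cl n} {x : Euc n} (i : Fin (n + 1))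
    (hA : DifferentiableAt ℝ A x) (hF : DifferentiableAt ℝ F x) :
    pd i (fun y => A y * F y) x = pd i A x * F x + A x * pd i F x := by
  have h := ((mulCL n).hasFDerivAt_of_bilinear hA.hasFDerivAt hF.hasFDerivAt).fderiv
  simp only [mulCL_apply] at h
  simp only [pd, h]
  simp [mulCL_apply, add_comm]

lemma pd_const (i : Fin (n + 1)) (a : Cl n) (x : Euc n) : pd i (fun _ => a) x = 0 := by
  simp [pd]

lemma pd_const_mul {F : Euc n → Cl n} {x : Euc n} (i : Fin (n + 1)) (a : Cl n)
    (hF : DifferentiableAt ℝ F x) : pd i (fun y => a * F y) x = a * pd i F x := by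
  rw [pd_mul i (differentiableAt_const a) hF, pd_const, zero_mul, zero_add]

lemma pd_add {F G : Euc n → Cl n} {x : Euc n} (i : Fin (n + 1))
    (hF : DifferentiableAt ℝ F x) (hG : DifferentiableAt ℝ G x) :
    pd i (fun y => F y + G y) x = pd i F x + pd i G x := by
  simp [pd, fderiv_fun_add hF hG]

lemma pd_sum {ι : Type*} (s : Finset ι) {F : ι → Euc n → Cl n} {x : Euc n} (i : Fin (n + 1))
    (hF : ∀ a ∈ s, DifferentiableAt ℝ (F a) x) :
    pd i (fun y => ∑ a ∈ s, F a y) x = ∑ a ∈ s, pd i (F a) x := by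
  simp [pd, fderiv_fun_sum hF]

lemma pd_const_smul {F : Euc n → Cl n} {x : Euc n} (i : Fin (n + 1)) (r : ℝ)
    (hF : DifferentiableAt ℝ F x) : pd i (fun y => r • F y) x = r • pd i F x := by
  simp [pd, fderiv_fun_const_smul hF]

lemma pd_smul {c : Euc n → ℝ} {F : Euc n → Cl n} {x : Euc n} (i : Fin (n + 1))
    (hc : DifferentiableAt ℝ c x) (hF : DifferentiableAt ℝ F x) :
    pd i (fun y => c y • F y) x =
      c x • pd i F x + (fderiv ℝ c x (EuclideanSpace.single i 1)) • F x := by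
  simp [pd, fderiv_fun_smul hc hF]

lemma pd_congr {F G : Euc n → Cl n} {x : Euc n} (i : Fin (n + 1)) (h : F =ᶠ[nhds x] G) :
    pd i F x = pd i G x := by
  simp [pd, h.fderiv_eq]

lemma fderiv_apply_eq_sum_pd (F : Euc n → Cl n) (x v : Euc n) :
    fderiv ℝ F x v = ∑ i, v i • pd i F x := by
  have hv : v = ∑ i, v i • EuclideanSpace.single i (1 : ℝ) := by
    ext j
    simp [Pi.single_apply]
  conv_lhs => rw [hv]
  simp [pd]

lemma differentiableAt_pd {F : Euc n → Cl n} {x : Euc n} (i : Fin (n + 1))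
    (hF : ContDiffAt ℝ 2 F x) : DifferentiableAt ℝ (pd i F) x := by
  have h : DifferentiableAt ℝ (fderiv ℝ F) x :=
    (hF.fderiv_right (m := 1) (by norm_num)).differentiableAt (by norm_num)
  exact h.clm_apply (differentiableAt_const _)

lemma pd_pd {F : Euc n → Cl n} {x : Euc n} (i j : Fin (n + 1)) (hF : ContDiffAt ℝ 2 F x) :
    pd i (pd j F) x =
      fderiv ℝ (fderiv ℝ F) x (EuclideanSpace.single i 1) (EuclideanSpace.single j 1) := by
  have h : DifferentiableAt ℝ (fderiv ℝ F) x :=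
    (hF.fderiv_right (m := 1) (by norm_num)).differentiableAt (by norm_num)
  have := fderiv_clm_apply h (differentiableAt_const (EuclideanSpace.single j (1 : ℝ)))
  unfold pd
  rw [this]
  simp

lemma pd_comm {F : Euc n → Cl n} {x : Euc n} (i j : Fin (n + 1)) (hF : ContDiffAt ℝ 2 F x) :
    pd i (pd j F) x = pd j (pd i F) x := by
  rw [pd_pd i j hF, pd_pd j i hF]
  exact (hF.isSymmSndFDerivAt (by simp)).eq _ _

lemma laplacian_eq_sum_pd {F : Euc n → Cl n} {x : Euc n} (hF : ContDiffAt ℝ 2 F x) :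
    Laplacian.laplacian F x = ∑ i, pd i (pd i F) x := by
  rw [InnerProductSpace.laplacian_eq_iteratedFDeriv_orthonormalBasis F
    (EuclideanSpace.basisFun (Fin (n + 1)) ℝ)]
  refine Finset.sum_congr rfl fun i _ => ?_
  rw [iteratedFDeriv_two_apply, pd_pd i i hF]
  simp

/-- The Euler operator `∑ x_i ∂_i`. -/
def euler (F : Euc n → Cl n) (x : Euc n) : Cl n := ∑ i, x i • pd i F x

lemma euler_eq_fderiv (F : Euc n → Cl n) (x : Euc n) : euler F x = fderiv ℝ F x x :=
  (fderiv_apply_eq_sum_pd F x x).symm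

/-- Symmetry of the second derivatives turns Euler's relation `E F = 0` into
`E (∂_i F) = -∂_i F`. -/
lemma euler_pd {F : Euc n → Cl n} {x : Euc n} (i : Fin (n + 1)) (hF : ContDiffAt ℝ 2 F x)
    (h0 : euler F =ᶠ[nhds x] fun _ => 0) : euler (pd i F) x = -pd i F x := by
  have hd : ∀ j ∈ Finset.univ, DifferentiableAt ℝ (fun y : Euc n => y j • pd j F y) x :=
    fun j _ => (by fun_prop : DifferentiableAt ℝ (fun y : Euc n => y j) x).smul
      (differentiableAt_pd j hF)
  have h1 : pd i (euler F) x = 0 := by rw [pd_congr i h0, pd_const]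
  have h2 : pd i (euler F) x = euler (pd i F) x + pd i F x := by
    change pd i (fun y => ∑ j, y j • pd j F y) x = _
    rw [pd_sum _ i hd, euler]
    have hc : ∀ j : Fin (n + 1), fderiv ℝ (fun y : Euc n => y j) x (EuclideanSpace.single i 1)
        = if j = i then 1 else 0 := by
      intro j
      have : (fun y : Euc n => y j) = (EuclideanSpace.proj j : Euc n →L[ℝ] ℝ) := rfl
      rw [this, ContinuousLinearMap.fderiv]
      simp
    have : ∀ j, pd i (fun y : Euc n => y j • pd j F y) x =
        x j • pd j (pd i F) x + (if j = i then (1 : ℝ) else 0) • pd j F x := by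
      intro j
      rw [pd_smul i (by fun_prop) (differentiableAt_pd j hF), hc, pd_comm i j hF]
    simp only [this, Finset.sum_add_distrib]
    simp
  rw [h1] at h2
  exact eq_neg_of_add_eq_zero_left h2.symm

end Calculus

/-! ### Dirac operators -/

section Dirac

variable {n : ℕ}

lemma gen_mul_gen_add_swap (i j : Fin n) :
    (gen i * gen j + gen j * gen i : Cl n) = if i = j then -2 else 0 := by
  rw [gen, gen, CliffordAlgebra.ι_mul_ι_add_swap]
  simp only [QuadraticMap.polar, QuadraticMap.weightedSumSquares_apply]
  split_ifs with h
  · subst h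
    simp only [Pi.add_apply, Pi.single_apply]
    rw [← Finset.sum_sub_distrib, ← Finset.sum_sub_distrib, Finset.sum_eq_single i]
    · norm_num
      exact map_ofNat _ 2
    · intro j _ hj; simp [hj]
    · simp
  · rw [← Finset.sum_sub_distrib, ← Finset.sum_sub_distrib, Finset.sum_eq_zero, map_zero]
    intro k _
    simp only [Pi.add_apply, Pi.single_apply]
    split_ifs with h1 h2
    · exact absurd (h1.symm.trans h2) h
    all_goals norm_num

/-- The paravector units `1, e₁, …, eₙ`. -/
def unit (a : Fin (n + 1)) : Cl n := Fin.cons (α := fun _ => Cl n) 1 gen a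

/-- The conjugate paravector units `1, -e₁, …, -eₙ`. -/
def unitBar (a : Fin (n + 1)) : Cl n := Fin.cons (α := fun _ => Cl n) 1 (fun j => -gen j) a

/-- The relation `u_a v_b + u_b v_a = 2 δ_{ab}` between a family and its conjugate. -/
def IsConj (u v : Fin (n + 1) → Cl n) : Prop :=
  ∀ a b, u a * v b + u b * v a = if a = b then 2 else 0

lemma isConj_unit_unitBar : IsConj (unit (n := n)) unitBar := by
  intro a b
  induction a using Fin.cases with
  | zero =>
    induction b using Fin.cases with
    | zero => simp [unit, unitBar]; norm_num
    | succ j => simp [unit, unitBar, (Fin.succ_ne_zero j).symm]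
  | succ i =>
    induction b using Fin.cases with
    | zero => simp [unit, unitBar]
    | succ j =>
      have := gen_mul_gen_add_swap i j
      simp only [unit, unitBar, Fin.cons_succ, mul_neg, ← neg_add, this, Fin.succ_inj]
      split_ifs <;> simp

lemma isConj_unitBar_unit : IsConj (unitBar (n := n)) unit := by
  intro a b
  induction a using Fin.cases with
  | zero =>
    induction b using Fin.cases with
    | zero => simp [unit, unitBar]; norm_num
    | succ j => simp [unit, unitBar, (Fin.succ_ne_zero j).symm]
  | succ i =>
    induction b using Fin.cases with
    | zero => simp [unit, unitBar]
    | succ j =>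
      have := gen_mul_gen_add_swap i j
      simp only [unit, unitBar, Fin.cons_succ, neg_mul, ← neg_add, this, Fin.succ_inj]
      split_ifs <;> simp

/-- The linear function `∑ x_a u_a`. -/
def lin (u : Fin (n + 1) → Cl n) (x : Euc n) : Cl n := ∑ a, x a • u a

/-- The first order operator `∑ u_a ∂_a`. -/
def dirac (u : Fin (n + 1) → Cl n) (F : Euc n → Cl n) (x : Euc n) : Cl n := ∑ a, u a * pd a F x

lemma para_eq_lin (x : Euc n) : para x = lin unit x := by
  simp [para, lin, unit, Fin.sum_univ_succ, Algebra.algebraMap_eq_smul_one]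

lemma paraBar_eq_lin (x : Euc n) : paraBar x = lin unitBar x := by
  simp [paraBar, lin, unitBar, Fin.sum_univ_succ, Algebra.algebraMap_eq_smul_one, sub_eq_add_neg]

lemma two_smul_sum_sum {M ι : Type*} [AddCommGroup M] [Module ℝ M] [Fintype ι]
    (f : ι → ι → M) : (2 : ℝ) • ∑ a, ∑ b, f a b = ∑ a, ∑ b, (f a b + f b a) := by
  simp only [Finset.sum_add_distrib]
  rw [Finset.sum_comm (f := fun a b => f b a), two_smul]

/-- Doubling the double sum pairs the terms `(a, b)` and `(b, a)`, and the relation of the pair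
leaves only the diagonal. -/
lemma IsConj.lin_mul_lin {u v : Fin (n + 1) → Cl n} (h : IsConj u v) (x : Euc n) :
    lin u x * lin v x = (‖x‖ ^ 2) • 1 := by
  have h2 : (2 : ℝ) • (lin u x * lin v x) = (2 : ℝ) • ((‖x‖ ^ 2) • (1 : Cl n)) := by
    simp only [lin, Finset.sum_mul_sum, smul_mul_smul_comm]
    rw [two_smul_sum_sum]
    have : ∀ a b, (x a * x b) • (u a * v b) + (x b * x a) • (u b * v a) =
        if a = b then (x a ^ 2 * 2) • (1 : Cl n) else 0 := by
      intro a b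
      rw [mul_comm (x b), ← smul_add, h]
      split_ifs with hab
      · subst hab
        rw [mul_smul (x a ^ 2), two_smul, one_add_one_eq_two, pow_two]
      · simp
    simp only [this, Finset.sum_ite_eq, Finset.mem_univ, if_true]
    rw [EuclideanSpace.norm_sq_eq, ← Finset.sum_smul, smul_smul, Finset.mul_sum]
    simp [mul_comm]
  exact smul_right_injective _ (two_ne_zero (α := ℝ)) h2

lemma IsConj.lin_mul_lin_sphere {u v : Fin (n + 1) → Cl n} (h : IsConj u v) (w : Sph n) :
    lin u (w : Euc n) * lin v (w : Euc n) = 1 := by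
  simp [h.lin_mul_lin]

@[fun_prop]
lemma differentiable_lin (u : Fin (n + 1) → Cl n) : Differentiable ℝ (lin u) := by
  unfold lin
  fun_prop

lemma fderiv_coord (i j : Fin (n + 1)) (x : Euc n) :
    fderiv ℝ (fun y : Euc n => y j) x (EuclideanSpace.single i 1) = if j = i then 1 else 0 := by
  have : (fun y : Euc n => y j) = (EuclideanSpace.proj j : Euc n →L[ℝ] ℝ) := rfl
  rw [this, ContinuousLinearMap.fderiv]
  simp

lemma pd_lin (u : Fin (n + 1) → Cl n) (a : Fin (n + 1)) (x : Euc n) : pd a (lin u) x = u a := by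
  have : ∀ b, pd a (fun y : Euc n => y b • u b) x = (if b = a then (1 : ℝ) else 0) • u b := by
    intro b
    rw [pd_smul a (by fun_prop) (by fun_prop), fderiv_coord, pd_const, smul_zero, zero_add]
  change pd a (fun y => ∑ b, y b • u b) x = _
  rw [pd_sum _ a (fun b _ => by fun_prop)]
  simp [this]

lemma IsConj.mul_self {u v : Fin (n + 1) → Cl n} (h : IsConj u v) (a : Fin (n + 1)) :
    u a * v a = 1 := by
  have := h a a
  rw [if_pos rfl, ← two_mul] at this
  have h2 : (2 : ℝ) • (u a * v a) = (2 : ℝ) • (1 : Cl n) := by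
    rw [two_smul, two_smul, ← two_mul, this, one_add_one_eq_two]
  exact smul_right_injective _ (two_ne_zero (α := ℝ)) h2

/-- The commutation of `∑ u_a ∂_a` with the multiplication by `∑ x_a v_a`. -/
lemma IsConj.dirac_lin_mul {u v : Fin (n + 1) → Cl n} (h : IsConj u v) {G : Euc n → Cl n}
    {x : Euc n} (hG : DifferentiableAt ℝ G x) :
    dirac u (fun y => lin v y * G y) x =
      ((n : ℝ) + 1) • G x + (2 : ℝ) • euler G x - lin u x * dirac v G x := by
  -- Moving `u_a` past `x̄` turns `x̄` into `x`; the terms `2x_a` add up to `2E`, and the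
  -- derivatives of `x̄` itself supply `∑ u_a v_a = n + 1`.
  have h1 : ∀ a, u a * lin v x = (2 * x a) • (1 : Cl n) - lin u x * v a := by
    intro a
    rw [eq_sub_iff_add_eq, lin, lin, Finset.mul_sum, Finset.sum_mul, ← Finset.sum_add_distrib]
    have : ∀ b, u a * (x b • v b) + x b • u b * v a =
        if a = b then x b • (2 : Cl n) else 0 := by
      intro b
      rw [mul_smul_comm, smul_mul_assoc, ← smul_add, h]
      split_ifs <;> simp
    simp only [this, Finset.sum_ite_eq, Finset.mem_univ, if_true]
    rw [mul_comm, mul_smul, two_smul, one_add_one_eq_two]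
  have h2 : ∀ a, u a * pd a (fun y => lin v y * G y) x =
      G x + ((2 : ℝ) • (x a • pd a G x) - lin u x * (v a * pd a G x)) := by
    intro a
    rw [pd_mul a (by fun_prop) hG, pd_lin, mul_add, ← mul_assoc, ← mul_assoc, h.mul_self, one_mul,
      h1, sub_mul, smul_mul_assoc, one_mul, mul_smul, mul_assoc]
  simp only [dirac, h2, Finset.sum_add_distrib, Finset.sum_sub_distrib, euler, Finset.mul_sum,
    Finset.smul_sum]
  simp only [Finset.sum_const, Finset.card_univ, Fintype.card_fin, add_sub_assoc]
  rw [← Nat.cast_smul_eq_nsmul ℝ]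
  push_cast
  rfl

lemma differentiableAt_dirac {u : Fin (n + 1) → Cl n} {F : Euc n → Cl n} {x : Euc n}
    (hF : ContDiffAt ℝ 2 F x) : DifferentiableAt ℝ (dirac u F) x := by
  unfold dirac
  exact DifferentiableAt.fun_sum fun a _ =>
    (differentiableAt_const (u a)).cl_mul (differentiableAt_pd a hF)

/-- Second derivatives commute, so only the symmetric part `δ_ab` of `u_a v_b` survives. -/
lemma IsConj.dirac_dirac {u v : Fin (n + 1) → Cl n} (h : IsConj u v) {F : Euc n → Cl n}
    {x : Euc n} (hF : ContDiffAt ℝ 2 F x) :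
    dirac u (dirac v F) x = Laplacian.laplacian F x := by
  have h1 : ∀ a, pd a (dirac v F) x = ∑ b, v b * pd a (pd b F) x := by
    intro a
    change pd a (fun y => ∑ b, v b * pd b F y) x = _
    rw [pd_sum _ a (fun b _ =>
      (differentiableAt_const (v b)).cl_mul (differentiableAt_pd b hF))]
    exact Finset.sum_congr rfl fun b _ => pd_const_mul a _ (differentiableAt_pd b hF)
  rw [laplacian_eq_sum_pd hF]
  apply smul_right_injective _ (two_ne_zero (α := ℝ))
  change (2 : ℝ) • (∑ a, u a * pd a (dirac v F) x) = (2 : ℝ) • _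
  simp only [h1, Finset.mul_sum, ← mul_assoc]
  rw [two_smul_sum_sum]
  have h2 : ∀ a b, u a * v b * pd a (pd b F) x + u b * v a * pd b (pd a F) x =
      if a = b then (2 : ℝ) • pd a (pd a F) x else 0 := by
    intro a b
    rw [pd_comm b a hF, ← add_mul, h]
    split_ifs with hab
    · rw [hab, two_smul, two_mul]
    · simp
  simp [h2, Finset.smul_sum]

/-- The operator `Γ = (∑ x_a v_a) (∑ u_a ∂_a) - E`. -/
def gam (u v : Fin (n + 1) → Cl n) (F : Euc n → Cl n) (x : Euc n) : Cl n :=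
  lin v x * dirac u F x - euler F x

lemma sum_sum_eq_diag_add {M : Type*} [AddCommGroup M] (f : Fin n → Fin n → M) :
    ∑ i, ∑ j, f i j = (∑ i, f i i) +
      ∑ i, ∑ j ∈ Finset.univ.filter (fun j : Fin n => i < j), (f i j + f j i) := by
  have h1 : ∀ i j, f i j = (if i = j then f i i else 0) + (if i < j then f i j else 0) +
      (if j < i then f i j else 0) := by
    intro i j
    rcases lt_trichotomy i j with h | h | h
    · simp [h, h.ne, h.not_gt]
    · simp [h]
    · simp [h, h.ne', h.not_gt]
  have h2 : ∑ i, ∑ j, f i j = ∑ i, ∑ j, ((if i = j then f i i else 0) +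
      (if i < j then f i j else 0) + (if j < i then f i j else 0)) := by
    simp only [← h1]
  rw [h2]
  simp only [Finset.sum_add_distrib, Finset.sum_filter]
  rw [add_assoc, Finset.sum_comm (f := fun i j => if j < i then f i j else 0)]
  simp

lemma mul_ang (a : Cl n) (i j : Fin (n + 1)) (F : Euc n → Cl n) (x : Euc n) :
    a * ang i j F x = x i • (a * pd j F x) - x j • (a * pd i F x) := by
  rw [ang, ← mul_smul_comm, ← mul_smul_comm]
  exact mul_sub a _ _

/-- The diagonal contributes through `e_i² = -1`; off the diagonal, anticommutation joins `(i, j)`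
and `(j, i)` into one angular derivative. -/
lemma sum_gen_gen (F : Euc n → Cl n) (x : Euc n) :
    ∑ i : Fin n, ∑ j : Fin n, x i.succ • (gen i * gen j * pd j.succ F x) =
      -(∑ i : Fin n, x i.succ • pd i.succ F x) + angBivector F x := by
  rw [sum_sum_eq_diag_add, angBivector, ← Finset.sum_neg_distrib]
  congr 1
  · refine Finset.sum_congr rfl fun i _ => ?_
    have h := gen_mul_gen_add_swap i i
    have h2 : (gen i * gen i : Cl n) = -1 := by
      rw [if_pos rfl] at h
      apply smul_right_injective _ (two_ne_zero (α := ℝ))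
      simp only [two_smul, h]
      norm_num
    rw [h2]; simp
  · refine Finset.sum_congr rfl fun i _ => Finset.sum_congr rfl fun j hj => ?_
    have hij : i ≠ j := (Finset.mem_filter.1 hj).2.ne
    have h := gen_mul_gen_add_swap i j
    rw [if_neg hij] at h
    rw [eq_neg_of_add_eq_zero_right h, mul_ang]
    simp [sub_eq_add_neg]

/-- Expanding `x̄∂`, the scalar terms form exactly the Euler operator, which `gam` subtracts, and
what remains are angular derivatives. -/
lemma gammaEuc_eq_gam (F : Euc n → Cl n) (x : Euc n) : gammaEuc F x = gam unit unitBar F x := by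
  have h := sum_gen_gen F x
  rw [Finset.sum_comm] at h
  rw [gammaEuc, gam, lin, dirac, euler, Fin.sum_univ_succ, Fin.sum_univ_succ, Fin.sum_univ_succ]
  simp only [unit, unitBar, Fin.cons_zero, Fin.cons_succ, one_mul]
  simp only [add_mul, mul_add, Finset.sum_mul, Finset.mul_sum, smul_mul_assoc, one_mul, neg_mul,
    smul_neg, Finset.sum_neg_distrib, ← mul_assoc, mul_ang,
    Finset.sum_sub_distrib, Finset.sum_add_distrib, h]
  abel

lemma gammaBarEuc_eq_gam (F : Euc n → Cl n) (x : Euc n) :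
    gammaBarEuc F x = gam unitBar unit F x := by
  have h := sum_gen_gen F x
  rw [Finset.sum_comm] at h
  rw [gammaBarEuc, gam, lin, dirac, euler, Fin.sum_univ_succ, Fin.sum_univ_succ,
    Fin.sum_univ_succ]
  simp only [unit, unitBar, Fin.cons_zero, Fin.cons_succ, one_mul]
  simp only [add_mul, mul_add, Finset.sum_mul, Finset.mul_sum, smul_mul_assoc, one_mul, neg_mul,
    mul_neg, Finset.sum_neg_distrib, ← mul_assoc, mul_ang,
    Finset.sum_sub_distrib, Finset.sum_add_distrib, h]
  abel

end Dirac

/-! ### Radial extensions -/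

section Radial

variable {n : ℕ}

lemma radialExt_sphere (f : Sph n → Cl n) (w : Sph n) : radialExt f w = f w := by
  rw [radialExt, dif_pos (sph_ne_zero w)]
  congr 1
  apply Subtype.ext
  simp

lemma radialExt_smul (f : Sph n → Cl n) {r : ℝ} (hr : 0 < r) (x : Euc n) :
    radialExt f (r • x) = radialExt f x := by
  by_cases hx : x = 0
  · simp [hx]
  · have h : r • x ≠ 0 := smul_ne_zero hr.ne' hx
    rw [radialExt, radialExt, dif_pos h, dif_pos hx]
    congr 1
    apply Subtype.ext
    simp only [norm_smul, Real.norm_of_nonneg hr.le, smul_smul]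
    congr 1
    field_simp

lemma radialExt_of_eqOn {f : Sph n → Cl n} {K : Euc n → Cl n} (h : ∀ w : Sph n, f w = K w)
    {x : Euc n} (hx : x ≠ 0) : radialExt f x = K (‖x‖⁻¹ • x) := by
  rw [radialExt, dif_pos hx, h]

/-- The extension is constant along rays. No regularity is needed, because `fderiv` is `0` where the
derivative does not exist. -/
lemma euler_radialExt (f : Sph n → Cl n) (x : Euc n) : euler (radialExt f) x = 0 := by
  rw [euler_eq_fderiv]
  by_cases hd : DifferentiableAt ℝ (radialExt f) x
  · have h1 : HasDerivAt (fun t : ℝ => t • x) x 1 := by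
      simpa using (hasDerivAt_id (1 : ℝ)).smul_const x
    have h2 : HasFDerivAt (radialExt f) (fderiv ℝ (radialExt f) x) ((1 : ℝ) • x) := by
      simpa using hd.hasFDerivAt
    have h3 := h2.comp_hasDerivAt 1 h1
    have h4 : HasDerivAt (radialExt f ∘ fun t : ℝ => t • x) 0 1 := by
      refine (hasDerivAt_const (1 : ℝ) (radialExt f x)).congr_of_eventuallyEq ?_
      filter_upwards [lt_mem_nhds (zero_lt_one' ℝ)] with t ht
      exact radialExt_smul f ht x
    exact h3.unique h4
  · simp [fderiv_zero_of_not_differentiableAt hd]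

/-- The derivative is the orthogonal projection onto the tangent space at `w`. -/
lemma hasFDerivAt_normalize (w : Sph n) :
    HasFDerivAt (fun x : Euc n => ‖x‖⁻¹ • x)
      (ContinuousLinearMap.id ℝ (Euc n) -
        (innerSL ℝ (w : Euc n)).smulRight (w : Euc n)) (w : Euc n) := by
  have hw : ‖(w : Euc n)‖ = 1 := by simp
  have h1 : HasFDerivAt (fun x : Euc n => ‖x‖ ^ 2) (2 • innerSL ℝ (w : Euc n)) (w : Euc n) :=
    (hasStrictFDerivAt_norm_sq (w : Euc n)).hasFDerivAt
  have h2 : HasFDerivAt (fun x : Euc n => (Real.sqrt (‖x‖ ^ 2))⁻¹)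
      (-(innerSL ℝ (w : Euc n))) (w : Euc n) := by
    refine ((hasDerivAt_inv (by simp [hw])).comp_hasFDerivAt _
      (h1.sqrt (by simp [hw]))).congr_fderiv ?_
    ext v
    simp [hw]
  have h3 : HasFDerivAt (fun x : Euc n => ‖x‖⁻¹) (-(innerSL ℝ (w : Euc n))) (w : Euc n) := by
    simpa using h2
  refine (h3.fun_smul (hasFDerivAt_id (w : Euc n))).congr_fderiv ?_
  refine ContinuousLinearMap.ext fun v => ?_
  simp [hw, sub_eq_add_neg]

/-- The radial extension of the restriction of `K` to the sphere has the derivatives of `K` in the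
tangential directions, and vanishing radial derivative. -/
lemma pd_radialExt {f : Sph n → Cl n} {K : Euc n → Cl n} (h : ∀ w : Sph n, f w = K w)
    (w : Sph n) (hK : DifferentiableAt ℝ K w) (i : Fin (n + 1)) :
    pd i (radialExt f) w = pd i K w - (w : Euc n) i • euler K w := by
  have hw : ‖(w : Euc n)‖⁻¹ • (w : Euc n) = w := by simp
  have h1 : HasFDerivAt K (fderiv ℝ K w) (‖(w : Euc n)‖⁻¹ • (w : Euc n)) := by
    rw [hw]; exact hK.hasFDerivAt
  have h2 := HasFDerivAt.comp (f := fun x : Euc n => ‖x‖⁻¹ • x) (w : Euc n) h1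
    (hasFDerivAt_normalize w)
  have h3 : radialExt f =ᶠ[nhds (w : Euc n)] K ∘ fun x => ‖x‖⁻¹ • x := by
    filter_upwards [isOpen_ne.mem_nhds (sph_ne_zero w)] with x hx
    exact radialExt_of_eqOn h hx
  rw [pd, h3.fderiv_eq, h2.fderiv, euler_eq_fderiv, pd]
  simp [EuclideanSpace.inner_single_right]

/-- `Γ` is tangential: the radial part of `∂` is `xE`, and `x̄xE = E` on the sphere cancels the
subtracted Euler term. Hence `Γf` may be computed from any differentiable extension, in particular
from `x̄∂F` when `Γ` is iterated. -/
lemma gam_radialExt {u v : Fin (n + 1) → Cl n} (huv : IsConj v u) {f : Sph n → Cl n}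
    {K : Euc n → Cl n} (h : ∀ w : Sph n, f w = K w) (w : Sph n) (hK : DifferentiableAt ℝ K w) :
    gam u v (radialExt f) w = gam u v K w := by
  have h1 : dirac u (radialExt f) w = dirac u K w - lin u (w : Euc n) * euler K w := by
    simp only [dirac, pd_radialExt h w hK, lin, Finset.sum_mul, ← Finset.sum_sub_distrib]
    refine Finset.sum_congr rfl fun a _ => ?_
    rw [smul_mul_assoc, ← mul_smul_comm]
    exact mul_sub _ _ _
  rw [gam, gam, euler_radialExt, h1, sub_zero]
  have : lin v (w : Euc n) * (dirac u K w - lin u (w : Euc n) * euler K w) =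
    lin v (w : Euc n) * dirac u K w - lin v (w : Euc n) * (lin u (w : Euc n) * euler K w) :=
    mul_sub _ _ _
  rw [this, ← mul_assoc (lin v (w : Euc n)), huv.lin_mul_lin_sphere, one_mul]

lemma euler_lin_mul (v : Fin (n + 1) → Cl n) {G : Euc n → Cl n} {x : Euc n}
    (hG : DifferentiableAt ℝ G x) :
    euler (fun y => lin v y * G y) x = lin v x * G x + lin v x * euler G x := by
  simp only [euler, pd_mul _ (differentiable_lin v x) hG, pd_lin, smul_add,
    Finset.sum_add_distrib]
  congr 1
  · simp [lin, Finset.sum_mul]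
  · simp [Finset.mul_sum]

/-- Differentiation lowers the degree of homogeneity from `0` to `-1`. -/
lemma euler_dirac {u : Fin (n + 1) → Cl n} {F : Euc n → Cl n} {x : Euc n}
    (hF : ContDiffAt ℝ 2 F x) (h0 : euler F =ᶠ[nhds x] fun _ => 0) :
    euler (dirac u F) x = -dirac u F x := by
  have h1 : ∀ a, pd a (dirac u F) x = ∑ b, u b * pd a (pd b F) x := by
    intro a
    change pd a (fun y => ∑ b, u b * pd b F y) x = _
    rw [pd_sum _ a (fun b _ =>
      (differentiableAt_const (u b)).cl_mul (differentiableAt_pd b hF))]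
    exact Finset.sum_congr rfl fun b _ => pd_const_mul a _ (differentiableAt_pd b hF)
  have h2 : euler (dirac u F) x = ∑ b, u b * euler (pd b F) x := by
    simp only [euler, h1, Finset.smul_sum, Finset.mul_sum]
    rw [Finset.sum_comm]
    simp
  rw [h2, dirac, ← Finset.sum_neg_distrib]
  refine Finset.sum_congr rfl fun b _ => ?_
  rw [euler_pd b hF h0]
  exact mul_neg _ _

lemma pd_add_smul {A B : Euc n → Cl n} {x : Euc n} (a : Fin (n + 1)) (r : ℝ)
    (hA : DifferentiableAt ℝ A x) (hB : DifferentiableAt ℝ B x) :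
    pd a (fun y => A y + r • B y) x = pd a A x + r • pd a B x := by
  rw [pd_add a hA (hB.fun_const_smul r), pd_const_smul a r hB]

lemma euler_add_smul {A B : Euc n → Cl n} {x : Euc n} (r : ℝ)
    (hA : DifferentiableAt ℝ A x) (hB : DifferentiableAt ℝ B x) :
    euler (fun y => A y + r • B y) x = euler A x + r • euler B x := by
  simp only [euler, pd_add_smul _ r hA hB, smul_add, Finset.sum_add_distrib, Finset.smul_sum,
    smul_comm r]

lemma dirac_add_smul {A B : Euc n → Cl n} {x : Euc n} (u : Fin (n + 1) → Cl n) (r : ℝ)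
    (hA : DifferentiableAt ℝ A x) (hB : DifferentiableAt ℝ B x) :
    dirac u (fun y => A y + r • B y) x = dirac u A x + r • dirac u B x := by
  simp only [dirac, pd_add_smul _ r hA hB, mul_add, Finset.sum_add_distrib, Finset.smul_sum,
    mul_smul_comm]

/-- `Γ` on functions on the sphere. -/
def gamS (u v : Fin (n + 1) → Cl n) (f : Sph n → Cl n) : Sph n → Cl n :=
  fun w => gam u v (radialExt f) w

lemma gammaS_eq_gamS (f : Sph n → Cl n) : gammaS f = gamS unit unitBar f :=
  funext fun _ => gammaEuc_eq_gam _ _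

lemma gammaBarS_eq_gamS (f : Sph n → Cl n) : gammaBarS f = gamS unitBar unit f :=
  funext fun _ => gammaBarEuc_eq_gam _ _

/-! ### Quadratic formula and factorization for `C²` functions -/

section TwiceDifferentiable

variable {f : Sph n → Cl n} {u v : Fin (n + 1) → Cl n}

lemma contDiffAt_two_radialExt (hf : ContMDiff (𝓡 n) 𝓘(ℝ, Cl n) 2 f)
    {x : Euc n} (hx : x ≠ 0) : ContDiffAt ℝ 2 (radialExt f) x :=
  contDiffAt_radialExt (k := 2) hf hx

lemma gamS_eq_lin_mul_dirac (f : Sph n → Cl n) (u v : Fin (n + 1) → Cl n) (w : Sph n) :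
    gamS u v f w = lin v (w : Euc n) * dirac u (radialExt f) w := by
  rw [gamS, gam, euler_radialExt, sub_zero]

/-- With `G = ∂F` of degree `-1`, the function `x̄G` has degree `0`, so `Γ²f = x̄∂(x̄G) = x̄((n+1)G
- 2G - xΔF)`, and `x̄x = 1` on the sphere. -/
lemma gamS_gamS (hf : ContMDiff (𝓡 n) 𝓘(ℝ, Cl n) 2 f)
    (huv : IsConj u v) (hvu : IsConj v u) (w : Sph n) :
    gamS u v (gamS u v f) w = ((n : ℝ) - 1) • gamS u v f w - beltramiS f w := by
  have hF := contDiffAt_two_radialExt hf (sph_ne_zero w)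
  have hD := differentiableAt_dirac (u := u) hF
  have h0 : euler (radialExt f) =ᶠ[nhds (w : Euc n)] fun _ => 0 :=
    Filter.Eventually.of_forall fun x => euler_radialExt f x
  rw [gamS, gam_radialExt hvu (gamS_eq_lin_mul_dirac f u v) w
    ((differentiable_lin v _).cl_mul hD), gam, euler_lin_mul v hD, huv.dirac_lin_mul hD,
    euler_dirac hF h0, hvu.dirac_dirac hF, gamS_eq_lin_mul_dirac f u v, beltramiS]
  generalize dirac u (radialExt f) w = G
  generalize Laplacian.laplacian (radialExt f) (w : Euc n) = B
  have h1 := hvu.lin_mul_lin_sphere w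
  have h2 : lin v (w : Euc n) * (((n : ℝ) + 1) • G + (2 : ℝ) • -G - lin u (w : Euc n) * B) =
    ((n : ℝ) + 1) • (lin v (w : Euc n) * G) + (2 : ℝ) • -(lin v (w : Euc n) * G) -
      lin v (w : Euc n) * lin u (w : Euc n) * B := by
    rw [mul_assoc, ← mul_smul_comm, ← mul_neg, ← mul_smul_comm, ← mul_add]
    exact mul_sub _ _ _
  have h3 : lin v (w : Euc n) * -G = -(lin v (w : Euc n) * G) := mul_neg _ _
  rw [h2, h3, h1, one_mul]
  module

lemma laplace_eq_gamS (hf : ContMDiff (𝓡 n) 𝓘(ℝ, Cl n) 2 f)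
    (huv : IsConj u v) (hvu : IsConj v u) (w : Sph n) :
    laplaceS f w = -gamS u v (gamS u v f) w + ((n : ℝ) - 1) • gamS u v f w
        - ((n : ℝ) ^ 2 / 4 - (n : ℝ) / 2) • f w := by
  rw [gamS_gamS hf huv hvu]
  simp only [laplaceS, Pi.sub_apply, Pi.smul_apply]
  module

/-- The factorization `Δ_s = D̄ (D + w)`. -/
lemma laplace_eq_dirac_mul (hf : ContMDiff (𝓡 n) 𝓘(ℝ, Cl n) 2 f)
    (huv : IsConj u v) (hvu : IsConj v u) {g : Sph n → Cl n}
    (hg : ∀ w : Sph n, g w = lin u (w : Euc n) * (gamS u v f w + (1 - (n : ℝ) / 2) • f w))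
    (w : Sph n) :
    laplaceS f w = lin v (w : Euc n) * (gamS v u g w - ((n : ℝ) / 2) • g w) := by
  have hF := contDiffAt_two_radialExt hf (sph_ne_zero w)
  have hFd : DifferentiableAt ℝ (radialExt f) w := hF.differentiableAt (by norm_num)
  have hD := differentiableAt_dirac (u := u) hF
  have h0 : euler (radialExt f) =ᶠ[nhds (w : Euc n)] fun _ => 0 :=
    Filter.Eventually.of_forall fun x => euler_radialExt f x
  have hK1 : DifferentiableAt ℝ (fun y => lin v y * dirac u (radialExt f) y) (w : Euc n) :=
    (differentiable_lin v _).cl_mul hD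
  have hG : DifferentiableAt ℝ (fun y => lin v y * dirac u (radialExt f) y +
      (1 - (n : ℝ) / 2) • radialExt f y) (w : Euc n) := hK1.fun_add (hFd.fun_const_smul _)
  have heK : euler (fun y => lin v y * dirac u (radialExt f) y) (w : Euc n) = 0 := by
    rw [euler_lin_mul v hD, euler_dirac hF h0]
    have h3 : lin v (w : Euc n) * -(dirac u (radialExt f) w) =
      -(lin v (w : Euc n) * dirac u (radialExt f) w) := mul_neg _ _
    rw [h3, add_neg_cancel]
  have heG : euler (fun y => lin v y * dirac u (radialExt f) y +
      (1 - (n : ℝ) / 2) • radialExt f y) (w : Euc n) = 0 := by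
    rw [euler_add_smul _ hK1 hFd, heK, euler_radialExt, smul_zero, add_zero]
  have hdG : lin v (w : Euc n) * dirac u (fun y => lin v y * dirac u (radialExt f) y +
      (1 - (n : ℝ) / 2) • radialExt f y) (w : Euc n) =
      gamS u v (gamS u v f) w + (1 - (n : ℝ) / 2) • gamS u v f w := by
    rw [gamS, gam_radialExt hvu (gamS_eq_lin_mul_dirac f u v) w hK1, gam, heK, sub_zero,
      gamS_eq_lin_mul_dirac f u v, dirac_add_smul u _ hK1 hFd, mul_add, mul_smul_comm]
  have hgK : ∀ w : Sph n, g w = lin u (w : Euc n) *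
      (lin v (w : Euc n) * dirac u (radialExt f) w + (1 - (n : ℝ) / 2) • radialExt f w) := by
    intro w
    rw [hg, gamS_eq_lin_mul_dirac f u v, radialExt_sphere]
  -- This is the intertwining relation `Γ̄ w = w(n - Γ)`, applied to `(Γ + 1 - n/2)f`: in `x ∂̄(xG)
  -- - E(xG)` with `EG = 0`, the constant `n + 1` loses one to the Euler term.
  have h5 : gamS v u g w = lin u (w : Euc n) * ((n : ℝ) • (gamS u v f w +
      (1 - (n : ℝ) / 2) • f w)) - lin u (w : Euc n) * (gamS u v (gamS u v f) w +
        (1 - (n : ℝ) / 2) • gamS u v f w) := by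
    rw [gamS, gam_radialExt huv (K := fun y => lin u y * (lin v y * dirac u (radialExt f) y +
      (1 - (n : ℝ) / 2) • radialExt f y)) hgK w ((differentiable_lin u _).cl_mul hG), gam,
      euler_lin_mul u hG, hvu.dirac_lin_mul hG, heG, hdG, ← gamS_eq_lin_mul_dirac f u v,
      radialExt_sphere]
    generalize gamS u v f w + (1 - (n : ℝ) / 2) • f w = A
    generalize gamS u v (gamS u v f) w + (1 - (n : ℝ) / 2) • gamS u v f w = B
    have h6 : lin u (w : Euc n) * (((n : ℝ) + 1) • A + (2 : ℝ) • (0 : Cl n) - B) =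
      lin u (w : Euc n) * (((n : ℝ) + 1) • A + (2 : ℝ) • (0 : Cl n)) - lin u (w : Euc n) * B :=
      mul_sub _ _ _
    rw [h6]
    simp only [smul_zero, mul_zero, add_zero, mul_smul_comm]
    module
  -- What remains is the polynomial identity `(n/2 - Γ)(Γ + 1 - n/2) = -Γ² + (n-1)Γ - (n²/4 - n/2)`.
  rw [h5, hg, laplace_eq_gamS hf huv hvu]
  have h1 := hvu.lin_mul_lin_sphere w
  generalize gamS u v (gamS u v f) w = A
  generalize gamS u v f w = B
  generalize f w = C
  generalize lin u (w : Euc n) = U at *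
  generalize lin v (w : Euc n) = V at *
  have h2 : U * ((n : ℝ) • (B + (1 - (n : ℝ) / 2) • C)) - U * (A + (1 - (n : ℝ) / 2) • B) -
      ((n : ℝ) / 2) • (U * (B + (1 - (n : ℝ) / 2) • C)) =
      U * (((n : ℝ) / 2) • (B + (1 - (n : ℝ) / 2) • C) +
        (-1 : ℝ) • (A + (1 - (n : ℝ) / 2) • B)) := by
    simp only [mul_add, mul_smul_comm]
    module
  rw [h2, ← mul_assoc, h1, one_mul]
  module

end TwiceDifferentiable

/-- The formulas for the conformally invariant spherical Laplacian. -/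
theorem laplaceS_formulas {f : Sph n → Cl n} (hf : ContMDiff (𝓡 n) 𝓘(ℝ, Cl n) 2 f) :
    laplaceS f = diracBarS (diracS f + mulW f) ∧
    laplaceS f = diracS (diracBarS f + mulWBar f) ∧
    laplaceS f = -gammaS (gammaS f) + ((n : ℝ) - 1) • gammaS f
      - ((n : ℝ) ^ 2 / 4 - (n : ℝ) / 2) • f ∧
    laplaceS f = -gammaBarS (gammaBarS f) + ((n : ℝ) - 1) • gammaBarS f
      - ((n : ℝ) ^ 2 / 4 - (n : ℝ) / 2) • f := by
  have key : ∀ U A B : Cl n, U * (A - ((n : ℝ) / 2) • B) + U * B =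
      U * (A + (1 - (n : ℝ) / 2) • B) := by
    intro U A B
    rw [← mul_add]
    congr 1
    module
  refine ⟨funext fun w => ?_, funext fun w => ?_, funext fun w => ?_, funext fun w => ?_⟩
  · rw [laplace_eq_dirac_mul hf isConj_unit_unitBar isConj_unitBar_unit
      (g := diracS f + mulW f) (fun w => ?_) w]
    · simp only [diracBarS, mulWBar, gammaBarS_eq_gamS, paraBar_eq_lin]
      rfl
    · simp only [diracS, mulW, gammaS_eq_gamS, para_eq_lin, Pi.add_apply]
      exact key _ _ _
  · rw [laplace_eq_dirac_mul hf isConj_unitBar_unit isConj_unit_unitBar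
      (g := diracBarS f + mulWBar f) (fun w => ?_) w]
    · simp only [diracS, mulW, gammaS_eq_gamS, para_eq_lin]
      rfl
    · simp only [diracBarS, mulWBar, gammaBarS_eq_gamS, paraBar_eq_lin, Pi.add_apply]
      exact key _ _ _
  · rw [laplace_eq_gamS hf isConj_unit_unitBar isConj_unitBar_unit]
    simp only [gammaS_eq_gamS]
    rfl
  · rw [laplace_eq_gamS hf isConj_unitBar_unit isConj_unit_unitBar]
    simp only [gammaBarS_eq_gamS]
    rfl

end Radial

/-! ### Homogeneous polynomials -/

section Poly

variable {n : ℕ}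

/-- The function on `ℝ^{n+1}` defined by a polynomial. -/
def polyEval (P : MvPolynomial (Fin (n + 1)) ℝ) (x : Euc n) : ℝ :=
  MvPolynomial.eval (fun i => x i) P

lemma contDiff_polyEval (P : MvPolynomial (Fin (n + 1)) ℝ) : ContDiff ℝ ∞ (polyEval P) := by
  unfold polyEval
  simp only [MvPolynomial.eval_eq']
  fun_prop

@[fun_prop]
lemma differentiable_polyEval (P : MvPolynomial (Fin (n + 1)) ℝ) :
    Differentiable ℝ (polyEval P) :=
  (contDiff_polyEval P).differentiable (by simp)

lemma fderiv_polyEval (P : MvPolynomial (Fin (n + 1)) ℝ) (i : Fin (n + 1)) (x : Euc n) :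
    fderiv ℝ (polyEval P) x (EuclideanSpace.single i 1) =
      polyEval (MvPolynomial.pderiv i P) x := by
  induction P using MvPolynomial.induction_on with
  | C a =>
    have : polyEval (MvPolynomial.C a) = fun _ : Euc n => a := by
      funext x; simp [polyEval]
    rw [this]
    simp [polyEval]
  | add p q hp hq =>
    have : polyEval (p + q) = fun x : Euc n => polyEval p x + polyEval q x := by
      funext x; simp [polyEval]
    rw [this, fderiv_fun_add (by fun_prop) (by fun_prop), add_apply, hp, hq]
    simp [polyEval]
  | mul_X p j hp =>
    have : polyEval (p * MvPolynomial.X j) = fun x : Euc n => polyEval p x * x j := by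
      funext x; simp [polyEval]
    rw [this, fderiv_fun_mul (by fun_prop) (by fun_prop), add_apply,
      smul_apply, smul_apply, hp, fderiv_coord]
    by_cases h : j = i
    · subst h; simp [polyEval, MvPolynomial.pderiv_X]
    · simp [polyEval, MvPolynomial.pderiv_X, h]

lemma polyEval_smul {P : MvPolynomial (Fin (n + 1)) ℝ} {m : ℕ} (hP : P.IsHomogeneous m) (r : ℝ)
    (x : Euc n) : polyEval P (r • x) = r ^ m * polyEval P x := by
  unfold polyEval
  rw [MvPolynomial.eval_eq', MvPolynomial.eval_eq', Finset.mul_sum]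
  refine Finset.sum_congr rfl fun d hd => ?_
  have hm : ∑ i, d i = m := by
    rw [← hP (MvPolynomial.mem_support_iff.1 hd), Finsupp.weight_apply, Finsupp.sum_fintype]
    · simp
    · simp
  simp only [PiLp.smul_apply, smul_eq_mul, mul_pow, Finset.prod_mul_distrib]
  rw [Finset.prod_pow_eq_pow_sum, hm]
  ring

/-- The `Cl_n`-valued polynomial function `∑_A P_A e_A`. -/
def polyFun (P : Finset (Fin n) → MvPolynomial (Fin (n + 1)) ℝ) (x : Euc n) : Cl n :=
  ∑ A, polyEval (P A) x • clBasis n A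

lemma contDiff_polyFun (P : Finset (Fin n) → MvPolynomial (Fin (n + 1)) ℝ) :
    ContDiff ℝ ∞ (polyFun P) :=
  ContDiff.sum fun A _ => (contDiff_polyEval (P A)).smul contDiff_const

lemma differentiable_polyFun (P : Finset (Fin n) → MvPolynomial (Fin (n + 1)) ℝ) :
    Differentiable ℝ (polyFun P) :=
  (contDiff_polyFun P).differentiable (by simp)

lemma contMDiff_polyFun (P : Finset (Fin n) → MvPolynomial (Fin (n + 1)) ℝ) :
    ContMDiff (𝓡 n) 𝓘(ℝ, Cl n) ∞ fun w : Sph n => polyFun P w :=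
  (contDiff_polyFun P).contMDiff.comp contMDiff_coe_sphere

lemma pd_polyFun (P : Finset (Fin n) → MvPolynomial (Fin (n + 1)) ℝ) (i : Fin (n + 1)) :
    pd i (polyFun P) = polyFun fun A => MvPolynomial.pderiv i (P A) := by
  funext x
  change pd i (fun x => ∑ A, polyEval (P A) x • clBasis n A) x = _
  rw [pd_sum _ i (fun A _ => by fun_prop), polyFun]
  refine Finset.sum_congr rfl fun A _ => ?_
  rw [pd_smul i (by fun_prop) (by fun_prop), pd_const, smul_zero, zero_add, fderiv_polyEval]

lemma polyFun_smul {P : Finset (Fin n) → MvPolynomial (Fin (n + 1)) ℝ} {m : ℕ}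
    (hP : ∀ A, (P A).IsHomogeneous m) (r : ℝ) (x : Euc n) :
    polyFun P (r • x) = r ^ m • polyFun P x := by
  simp only [polyFun, polyEval_smul (hP _), mul_smul, Finset.smul_sum]

lemma euler_polyFun {P : Finset (Fin n) → MvPolynomial (Fin (n + 1)) ℝ} {m : ℕ}
    (hP : ∀ A, (P A).IsHomogeneous m) (x : Euc n) :
    euler (polyFun P) x = (m : ℝ) • polyFun P x := by
  simp only [euler, pd_polyFun, polyFun, Finset.smul_sum]
  rw [Finset.sum_comm]
  refine Finset.sum_congr rfl fun A _ => ?_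
  simp only [smul_smul, ← Finset.sum_smul]
  congr 1
  have h := congrArg (fun Q => polyEval Q x) (hP A).sum_X_mul_pderiv
  simpa [polyEval] using h

/-- The componentwise Laplacian of a family of polynomials. -/
def polyLap (P : Finset (Fin n) → MvPolynomial (Fin (n + 1)) ℝ) :
    Finset (Fin n) → MvPolynomial (Fin (n + 1)) ℝ :=
  fun A => ∑ i, MvPolynomial.pderiv i (MvPolynomial.pderiv i (P A))

lemma polyFun_polyLap (P : Finset (Fin n) → MvPolynomial (Fin (n + 1)) ℝ) (x : Euc n) :
    polyFun (polyLap P) x = ∑ i, pd i (pd i (polyFun P)) x := by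
  simp only [pd_polyFun]
  simp only [polyFun, polyLap, polyEval, map_sum, Finset.sum_smul]
  rw [Finset.sum_comm]

lemma hasFDerivAt_inv_norm {x : Euc n} (hx : x ≠ 0) :
    HasFDerivAt (fun y : Euc n => ‖y‖⁻¹) (-(‖x‖⁻¹ ^ 3) • innerSL ℝ x) x := by
  have hx' : ‖x‖ ≠ 0 := norm_ne_zero_iff.2 hx
  have h1 : HasFDerivAt (fun y : Euc n => ‖y‖ ^ 2) (2 • innerSL ℝ x) x :=
    (hasStrictFDerivAt_norm_sq x).hasFDerivAt
  have h2 : HasFDerivAt (fun y : Euc n => (Real.sqrt (‖y‖ ^ 2))⁻¹)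
      (-(‖x‖⁻¹ ^ 3) • innerSL ℝ x) x := by
    refine ((hasDerivAt_inv (by simpa using hx)).comp_hasFDerivAt _
      (h1.sqrt (by simpa using hx))).congr_fderiv ?_
    ext v
    simp
    field_simp
  simpa using h2

/-- Keeping the factor `‖x‖⁻¹ ^ m` avoids the truncated exponent `m - 1`, so that `m = 0` needs no
exception later. -/
lemma fderiv_inv_norm_pow {x : Euc n} (hx : x ≠ 0) (m : ℕ) (i : Fin (n + 1)) :
    DifferentiableAt ℝ (fun y : Euc n => ‖y‖⁻¹ ^ m) x ∧
    fderiv ℝ (fun y : Euc n => ‖y‖⁻¹ ^ m) x (EuclideanSpace.single i 1) =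
      -(m : ℝ) * ‖x‖⁻¹ ^ m * (‖x‖⁻¹ ^ 2 * x i) := by
  have h := (hasDerivAt_pow m ‖x‖⁻¹).comp_hasFDerivAt x (hasFDerivAt_inv_norm hx)
  refine ⟨h.differentiableAt, ?_⟩
  have h' := h.fderiv
  simp only [Function.comp_def] at h'
  rw [h']
  cases m with
  | zero => simp
  | succ k =>
    simp [EuclideanSpace.inner_single_right]
    ring

/-- The degree 0 extension is `|x|^{-m} P`. In its Laplacian at `|w| = 1`, Euler's relation `EP =
mP` and `∑ w_i² = 1` reduce everything to `ΔP` and a multiple of `P`. -/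
lemma beltramiS_polyFun {P : Finset (Fin n) → MvPolynomial (Fin (n + 1)) ℝ} {m : ℕ}
    (hP : ∀ A, (P A).IsHomogeneous m) (w : Sph n) :
    beltramiS (fun w : Sph n => polyFun P w) w =
      polyFun (polyLap P) w - ((m : ℝ) * ((m : ℝ) + n - 1)) • polyFun P w := by
  have hf : ContMDiff (𝓡 n) 𝓘(ℝ, Cl n) 2 fun w : Sph n => polyFun P w :=
    (contMDiff_polyFun P).of_le (by
      have h : ((2 : ℕ∞) : ℕ∞ω) ≤ ((⊤ : ℕ∞) : ℕ∞ω) := WithTop.coe_le_coe.2 le_top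
      exact h)
  have hw0 := sph_ne_zero w
  have hw : ‖(w : Euc n)‖ = 1 := by simp
  have hK : ∀ x, DifferentiableAt ℝ (polyFun P) x := fun x => differentiable_polyFun P x
  have hpK : ∀ i x, DifferentiableAt ℝ (pd i (polyFun P)) x := fun i x => by
    rw [pd_polyFun]; exact differentiable_polyFun _ x
  rw [beltramiS, laplacian_eq_sum_pd (contDiffAt_two_radialExt hf hw0), polyFun_polyLap]
  have h1 : ∀ x : Euc n, x ≠ 0 →
      radialExt (fun w : Sph n => polyFun P w) =ᶠ[nhds x] fun y => ‖y‖⁻¹ ^ m • polyFun P y := by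
    intro x hx
    filter_upwards [isOpen_ne.mem_nhds hx] with y hy
    rw [radialExt_of_eqOn (K := polyFun P) (fun _ => rfl) hy, polyFun_smul hP]
  have h2 : ∀ (i : Fin (n + 1)) (x : Euc n), x ≠ 0 →
      pd i (radialExt (fun w : Sph n => polyFun P w)) x =
        ‖x‖⁻¹ ^ m • (pd i (polyFun P) x + (-(m : ℝ) * (‖x‖⁻¹ ^ 2 * x i)) • polyFun P x) := by
    intro i x hx
    rw [pd_congr i (h1 x hx), pd_smul i (fderiv_inv_norm_pow hx m i).1 (hK x),
      (fderiv_inv_norm_pow hx m i).2]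
    module
  have h3 : ∀ i : Fin (n + 1), pd i (pd i (radialExt (fun w : Sph n => polyFun P w))) w =
      pd i (pd i (polyFun P)) w - (m : ℝ) • ((1 - 2 * (w : Euc n) i ^ 2) • polyFun P w)
        - (2 * (m : ℝ)) • ((w : Euc n) i • pd i (polyFun P) w)
        + ((m : ℝ) ^ 2 * (w : Euc n) i ^ 2) • polyFun P w := by
    intro i
    have h4 : pd i (radialExt (fun w : Sph n => polyFun P w)) =ᶠ[nhds (w : Euc n)]
        fun x => ‖x‖⁻¹ ^ m • (pd i (polyFun P) x +
          (-(m : ℝ) * (‖x‖⁻¹ ^ 2 * x i)) • polyFun P x) := by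
      filter_upwards [isOpen_ne.mem_nhds hw0] with y hy
      exact h2 i y hy
    obtain ⟨hd1, hd2⟩ := fderiv_inv_norm_pow hw0 m i
    obtain ⟨hd3, hd4⟩ := fderiv_inv_norm_pow hw0 2 i
    have hc : DifferentiableAt ℝ (fun y : Euc n => y i) (w : Euc n) := by fun_prop
    have hq : DifferentiableAt ℝ (fun x : Euc n => -(m : ℝ) * (‖x‖⁻¹ ^ 2 * x i)) (w : Euc n) :=
      (hd3.fun_mul hc).const_mul _
    have hq' : fderiv ℝ (fun x : Euc n => -(m : ℝ) * (‖x‖⁻¹ ^ 2 * x i)) (w : Euc n)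
        (EuclideanSpace.single i 1) = -(m : ℝ) * (1 - 2 * (w : Euc n) i ^ 2) := by
      rw [fderiv_const_mul (hd3.fun_mul hc), smul_apply,
        fderiv_fun_mul hd3 hc, add_apply, smul_apply,
        smul_apply, hd4, fderiv_coord,
        if_pos rfl, hw]
      simp only [smul_eq_mul]
      push_cast
      ring
    rw [pd_congr i h4, pd_smul i hd1 ((hpK i _).fun_add (hq.fun_smul (hK _))), hd2,
      pd_add i (hpK i _) (hq.fun_smul (hK _)), pd_smul i hq (hK _), hq', hw]
    simp only [inv_one, one_pow, one_mul, mul_one]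
    module
  simp only [h3]
  have hE : ∑ i, (w : Euc n) i • pd i (polyFun P) w = (m : ℝ) • polyFun P w :=
    euler_polyFun hP w
  have hN : ∑ i, (w : Euc n) i ^ 2 = 1 := by
    have := EuclideanSpace.real_norm_sq_eq (w : Euc n)
    rw [hw] at this
    simpa using this.symm
  rw [Finset.sum_add_distrib, Finset.sum_sub_distrib, Finset.sum_sub_distrib, ← Finset.smul_sum,
    ← Finset.smul_sum, ← Finset.sum_smul, ← Finset.sum_smul, hE, ← Finset.mul_sum, hN,
    Finset.sum_sub_distrib, ← Finset.mul_sum, hN]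
  simp only [Finset.sum_const, Finset.card_univ, Fintype.card_fin, nsmul_eq_mul]
  push_cast
  module

/-- The eigenvalue of `Δ_s` on the spherical harmonics of degree `m`. -/
def eigenval (n m : ℕ) : ℝ :=
  -(m : ℝ) ^ 2 - (m : ℝ) * ((n : ℝ) - 1) - ((n : ℝ) ^ 2 / 4 - (n : ℝ) / 2)

/-- Harmonicity is not assumed: the triangular form of `Δ_s` on polynomials is what later proves
completeness of the eigenfunctions. -/
lemma laplaceS_polyFun {P : Finset (Fin n) → MvPolynomial (Fin (n + 1)) ℝ} {m : ℕ}
    (hP : ∀ A, (P A).IsHomogeneous m) (w : Sph n) :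
    laplaceS (fun w : Sph n => polyFun P w) w =
      polyFun (polyLap P) w + eigenval n m • polyFun P w := by
  simp only [laplaceS, Pi.sub_apply, Pi.smul_apply, beltramiS_polyFun hP, eigenval]
  module

theorem laplaceS_sphHarm {m : ℕ} {h : Sph n → Cl n} (hh : h ∈ sphHarm n m) :
    ContMDiff (𝓡 n) 𝓘(ℝ, Cl n) ∞ h ∧ laplaceS h = eigenval n m • h := by
  obtain ⟨P, hP, hL, hw⟩ := hh
  have hh : h = fun w : Sph n => polyFun P w := funext hw
  rw [hh]
  refine ⟨contMDiff_polyFun P, funext fun w => ?_⟩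
  have h0 : polyLap P = fun _ => 0 := funext hL
  rw [laplaceS_polyFun hP, h0]
  simp [polyFun, polyEval]

end Poly

/-! ### Unbounded operators with a complete system of eigenspaces -/

section Operator

open Filter Topology

variable {H : Type*} [NormedAddCommGroup H] [InnerProductSpace ℝ H]

local notation "⟪" x ", " y "⟫" => inner ℝ x y

lemma eq_zero_of_inner_eq_zero {E : ℕ → Submodule ℝ H}
    (hdense : (⨆ k, E k).topologicalClosure = ⊤) {x : H}
    (hx : ∀ k, ∀ v ∈ E k, ⟪x, v⟫ = 0) : x = 0 := by
  have h1 : (⨆ k, E k) ≤ (Submodule.span ℝ {x})ᗮ :=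
    iSup_le fun k v hv => Submodule.mem_orthogonal_singleton_iff_inner_right.2 (hx k v hv)
  have h2 := Submodule.topologicalClosure_minimal _ h1 (Submodule.isClosed_orthogonal _)
  rw [hdense] at h2
  exact inner_self_eq_zero.1
    (Submodule.mem_orthogonal_singleton_iff_inner_right.1 (h2 (Submodule.mem_top (x := x))))

lemma clm_eq_of_eqOn {F : Type*} [NormedAddCommGroup F] [NormedSpace ℝ F] {E : ℕ → Submodule ℝ H}
    (hdense : (⨆ k, E k).topologicalClosure = ⊤) {S T : H →L[ℝ] F}
    (h : ∀ k, ∀ v ∈ E k, S v = T v) : S = T := by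
  have h1 : (⨆ k, E k) ≤ (S - T).ker :=
    iSup_le fun k v hv => by simp [h k v hv]
  have h2 := Submodule.topologicalClosure_minimal _ h1 (S - T).isClosed_ker
  rw [hdense] at h2
  ext x
  have := h2 (Submodule.mem_top (x := x))
  simpa [sub_eq_zero] using this

/-- A bounded sequence defines a bounded operator that is diagonal with respect to a total
orthogonal sequence of subspaces. -/
lemma exists_multiplier [CompleteSpace H] {E : ℕ → Submodule ℝ H}
    (hdense : (⨆ k, E k).topologicalClosure = ⊤)
    (hortho : ∀ i j, i ≠ j → ∀ v ∈ E i, ∀ w ∈ E j, ⟪v, w⟫ = 0)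
    {c : ℕ → ℝ} {C : ℝ} (hc : ∀ k, |c k| ≤ C) :
    ∃ M : H →L[ℝ] H, (∀ k, ∀ v ∈ E k, M v = c k • v) ∧ ∀ x y, ⟪M x, y⟫ = ⟪x, M y⟫ := by
  classical
  -- A Hilbert sum needs complete summands, so the `E k` are replaced by their closures.
  let F : ℕ → Submodule ℝ H := fun k => (E k).topologicalClosure
  have hFc : ∀ k, CompleteSpace (F k) := fun k =>
    (Submodule.isClosed_topologicalClosure (E k)).completeSpace_coe
  have hF1 : ∀ i j, i ≠ j → F i ≤ (F j)ᗮ := by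
    intro i j hij
    rw [Submodule.orthogonal_closure]
    refine Submodule.topologicalClosure_minimal _ ?_ (Submodule.isClosed_orthogonal _)
    intro v hv
    rw [Submodule.mem_orthogonal]
    intro w hw
    exact hortho j i hij.symm w hw v hv
  have hFo : OrthogonalFamily ℝ (fun i => F i) fun i => (F i).subtypeₗᵢ := by
    intro i j hij v w
    exact Submodule.inner_left_of_mem_orthogonal w.2 (hF1 i j hij v.2)
  have hFt : ⊤ ≤ (⨆ k, F k).topologicalClosure := by
    rw [← hdense]
    exact Submodule.topologicalClosure_mono
      (iSup_mono fun k => Submodule.le_topologicalClosure (E k))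
  have hV := IsHilbertSum.mkInternal F hFo hFt
  let U := hV.linearIsometryEquiv
  have hmem : ∀ f : lp (fun i => F i) 2, Memℓp (fun i => c i • f i) 2 := by
    intro f
    have h1 := (memℓp_gen_iff (p := 2) (by norm_num)).1 (lp.memℓp f)
    refine (memℓp_gen_iff (by norm_num)).2 (Summable.of_nonneg_of_le (fun i => by positivity)
      (fun i => ?_) (h1.mul_left (C ^ 2)))
    have h2 : |c i| ^ 2 ≤ C ^ 2 := pow_le_pow_left₀ (abs_nonneg _) (hc i) 2
    simp only [ENNReal.toReal_ofNat, Real.rpow_ofNat, norm_smul, mul_pow, Real.norm_eq_abs]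
    gcongr
  let D : lp (fun i => F i) 2 →ₗ[ℝ] lp (fun i => F i) 2 :=
    { toFun := fun f => ⟨fun i => c i • f i, hmem f⟩
      map_add' := fun f g => by
        apply lp.ext
        funext i
        exact smul_add (c i) (f i) (g i)
      map_smul' := fun r f => by
        apply lp.ext
        funext i
        exact smul_comm (c i) r (f i) }
  have hD : ∀ f i, (D f) i = c i • f i := fun f i => rfl
  have hDs : D.IsSymmetric := by
    intro f g
    rw [lp.inner_eq_tsum, lp.inner_eq_tsum]
    refine tsum_congr fun i => ?_
    rw [hD, hD, real_inner_smul_left, real_inner_smul_right]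
  -- Hellinger–Toeplitz: an everywhere defined symmetric operator is bounded. The bound `C` serves
  -- only to define `D` on all of `ℓ²`.
  let D' : lp (fun i => F i) 2 →L[ℝ] lp (fun i => F i) 2 := ⟨D, hDs.continuous⟩
  refine ⟨(U.symm.toContinuousLinearEquiv : lp (fun i => F i) 2 →L[ℝ] H) ∘L D' ∘L
    (U.toContinuousLinearEquiv : H →L[ℝ] lp (fun i => F i) 2), fun k v hv => ?_, fun x y => ?_⟩
  · have hv' : v ∈ F k := Submodule.le_topologicalClosure _ hv
    have h1 : U v = lp.single 2 k (⟨v, hv'⟩ : F k) :=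
      (U.symm_apply_eq.1 (hV.linearIsometryEquiv_symm_apply_single (⟨v, hv'⟩ : F k))).symm
    have h2 : D (U v) = c k • U v := by
      apply lp.ext
      funext i
      rw [hD, h1]
      by_cases hi : i = k
      · subst hi; rfl
      · simp [lp.single_apply, hi]
    change U.symm (D (U v)) = _
    rw [h2, map_smul, U.symm_apply_apply]
  · change ⟪U.symm (D (U x)), y⟫ = ⟪x, U.symm (D (U y))⟫
    rw [← U.inner_map_map, U.apply_symm_apply, hDs, ← U.inner_map_map x, U.apply_symm_apply]

variable {A : H →ₗ.[ℝ] H} {l : ℕ → ℝ} {E : ℕ → Submodule ℝ H}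

lemma inner_of_mem_closure_graph
    (hsym : ∀ p ∈ A.graph, ∀ k, ∀ v ∈ E k, ⟪p.2, v⟫ = l k * ⟪p.1, v⟫)
    {p : H × H} (hp : p ∈ A.graph.topologicalClosure) (k : ℕ) {v : H} (hv : v ∈ E k) :
    ⟪p.2, v⟫ = l k * ⟪p.1, v⟫ := by
  have hcl : IsClosed {p : H × H | ⟪p.2, v⟫ = l k * ⟪p.1, v⟫} :=
    isClosed_eq (by fun_prop) (by fun_prop)
  exact closure_minimal (fun q hq => hsym q hq k v hv) hcl hp

/-- `N` plays the role of `Ā M`. On each `E k` the pair is a multiple of an eigenpair, and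
membership in a closed subspace passes to the closure of the span. -/
lemma mem_closure_graph_of_multiplier (hdense : (⨆ k, E k).topologicalClosure = ⊤)
    (hE : ∀ k, ∀ v ∈ E k, (v, l k • v) ∈ A.graph) {M N : H →L[ℝ] H} {c : ℕ → ℝ}
    (hM : ∀ k, ∀ v ∈ E k, M v = c k • v) (hN : ∀ k, ∀ v ∈ E k, N v = (l k * c k) • v) (x : H) :
    (M x, N x) ∈ A.graph.topologicalClosure := by
  have h1 : (⨆ k, E k) ≤ A.graph.topologicalClosure.comap (M.prod N).toLinearMap := by
    refine iSup_le fun k v hv => ?_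
    refine Submodule.le_topologicalClosure _ ?_
    have h3 : (M.prod N).toLinearMap v = c k • (v, l k • v) := by
      simp [hM k v hv, hN k v hv, smul_smul, mul_comm]
    rw [h3]
    exact Submodule.smul_mem _ _ (hE k v hv)
  have h2 := Submodule.topologicalClosure_minimal _ h1
    ((Submodule.isClosed_topologicalClosure _).preimage (M.prod N).continuous)
  rw [hdense] at h2
  exact h2 (Submodule.mem_top (x := x))

/-- This is `M Ā = N` on the domain of `Ā`: paired with a vector of `E k`, both sides give `l k * c
k` times the same inner product. -/
lemma multiplier_of_mem_closure_graph (hdense : (⨆ k, E k).topologicalClosure = ⊤)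
    (hsym : ∀ p ∈ A.graph, ∀ k, ∀ v ∈ E k, ⟪p.2, v⟫ = l k * ⟪p.1, v⟫)
    {M N : H →L[ℝ] H} {c : ℕ → ℝ}
    (hM : ∀ k, ∀ v ∈ E k, M v = c k • v) (hN : ∀ k, ∀ v ∈ E k, N v = (l k * c k) • v)
    (hMs : ∀ x y, ⟪M x, y⟫ = ⟪x, M y⟫) (hNs : ∀ x y, ⟪N x, y⟫ = ⟪x, N y⟫)
    {p : H × H} (hp : p ∈ A.graph.topologicalClosure) : M p.2 = N p.1 := by
  rw [← sub_eq_zero]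
  refine eq_zero_of_inner_eq_zero hdense fun k v hv => ?_
  rw [inner_sub_left, hMs, hNs, hM k v hv, hN k v hv, real_inner_smul_right,
    real_inner_smul_right, inner_of_mem_closure_graph hsym hp k hv]
  ring

/-- If `(0, y)` lies in the closure of the graph, symmetry makes `y` orthogonal to every eigenspace.
-/
theorem isClosable_of_eigenspaces (hdense : (⨆ k, E k).topologicalClosure = ⊤)
    (hsym : ∀ p ∈ A.graph, ∀ k, ∀ v ∈ E k, ⟪p.2, v⟫ = l k * ⟪p.1, v⟫) : A.IsClosable := by
  refine ⟨A.graph.topologicalClosure.toLinearPMap,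
    (Submodule.toLinearPMap_graph_eq _ fun p hp hp1 => ?_).symm⟩
  refine eq_zero_of_inner_eq_zero hdense fun k v hv => ?_
  rw [inner_of_mem_closure_graph hsym hp k hv, hp1, inner_zero_left, mul_zero]

/-- For `z = a + ib` write `1/(l k - z) = α k + iβ k`. The resolvent on pairs is built from the real
multipliers `Ma`, `Mb` with these symbols, while `Na`, `Nb` stand for `Ā Ma`, `Ā Mb`. -/
theorem spectrumC_closure_of_eigenspaces [CompleteSpace H]
    (hdense : (⨆ k, E k).topologicalClosure = ⊤)
    (hsym : ∀ p ∈ A.graph, ∀ k, ∀ v ∈ E k, ⟪p.2, v⟫ = l k * ⟪p.1, v⟫)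
    (hE : ∀ k, ∀ v ∈ E k, (v, l k • v) ∈ A.graph) (hne : ∀ k, ∃ v ∈ E k, v ≠ 0)
    (hinj : Function.Injective l) (hlim : Tendsto l atTop atBot) :
    spectrumC A.closure = {z : ℂ | ∃ k, z = (l k : ℂ)} := by
  have hgr : ∀ p : H × H, p ∈ A.graph.topologicalClosure ↔ p ∈ A.closure.graph := by
    intro p
    rw [(isClosable_of_eigenspaces hdense hsym).graph_closure_eq_closure_graph]
  ext z
  refine ⟨fun hz => ?_, ?_⟩
  · by_contra hz'
    simp only [Set.mem_ofPred_eq, not_exists] at hz'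
    refine hz ?_
    have hortho : ∀ i j, i ≠ j → ∀ v ∈ E i, ∀ w ∈ E j, ⟪v, w⟫ = 0 := by
      intro i j hij v hv w hw
      have h := hsym _ (hE i v hv) j w hw
      rw [real_inner_smul_left] at h
      have h2 : (l i - l j) * ⟪v, w⟫ = 0 := by linarith
      exact (mul_eq_zero.1 h2).resolve_left (sub_ne_zero.2 (hinj.ne hij))
    set a := z.re with ha
    set b := z.im with hb
    let d : ℕ → ℝ := fun k => (l k - a) ^ 2 + b ^ 2
    have hd0 : ∀ k, 0 < d k := by
      intro k
      rcases eq_or_ne (l k) a with h | h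
      · have hb0 : b ≠ 0 := fun h0 => hz' k (Complex.ext (by simp [h, ha]) (by simp [← hb, h0]))
        have : 0 < b ^ 2 := by positivity
        exact add_pos_of_nonneg_of_pos (sq_nonneg _) this
      · have : 0 < (l k - a) ^ 2 := by
          have := sub_ne_zero.2 h
          positivity
        exact add_pos_of_pos_of_nonneg this (sq_nonneg _)
    -- Here `d k = |l k - z|²` is positive and tends to infinity; this uses `l k → -∞`.
    obtain ⟨C, hC⟩ : ∃ C, ∀ k, (d k)⁻¹ ≤ C := by
      have h1 : Tendsto (fun k => l k - a) atTop atBot := tendsto_atBot_add_const_right _ _ hlim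
      have h2 : Tendsto (fun k => (l k - a) ^ 2) atTop atTop := by
        simp only [pow_two]
        exact h1.atBot_mul_atBot₀ h1
      have h3 : Tendsto d atTop atTop := tendsto_atTop_add_const_right _ _ h2
      obtain ⟨C, hC⟩ := (tendsto_inv_atTop_zero.comp h3).bddAbove_range
      exact ⟨C, fun k => hC ⟨k, rfl⟩⟩
    let α : ℕ → ℝ := fun k => (l k - a) * (d k)⁻¹
    let β : ℕ → ℝ := fun k => b * (d k)⁻¹
    have hdd : ∀ k, d k * (d k)⁻¹ = 1 := fun k => mul_inv_cancel₀ (hd0 k).ne'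
    have hpos : ∀ k, 0 ≤ (d k)⁻¹ := fun k => (inv_pos.2 (hd0 k)).le
    -- Up to the constant `1` in `l k * α k`, all four symbols are combinations of `(l k - a)/d k`
    -- and `1/d k`, so one bound serves them all.
    have hbd : ∀ s t : ℝ, ∀ k, |s * (l k - a) * (d k)⁻¹ + t * (d k)⁻¹| ≤
        |s| * (1 + C) + |t| * C := by
      intro s t k
      have h1 : |(l k - a) * (d k)⁻¹| ≤ 1 + C := by
        rw [abs_mul, abs_of_nonneg (hpos k)]
        have h2 : |l k - a| ≤ d k + 1 := by
          have h4 := sq_abs (l k - a)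
          have h5 : d k = |l k - a| ^ 2 + b ^ 2 := by rw [h4]
          nlinarith [sq_nonneg (|l k - a| - 1), sq_nonneg b]
        calc |l k - a| * (d k)⁻¹ ≤ (d k + 1) * (d k)⁻¹ := by gcongr
          _ = 1 + (d k)⁻¹ := by rw [add_mul, hdd, one_mul]
          _ ≤ 1 + C := by linarith [hC k]
      calc |s * (l k - a) * (d k)⁻¹ + t * (d k)⁻¹|
          ≤ |s * (l k - a) * (d k)⁻¹| + |t * (d k)⁻¹| := abs_add_le _ _
        _ = |s| * |(l k - a) * (d k)⁻¹| + |t| * (d k)⁻¹ := by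
            rw [mul_assoc, abs_mul, abs_mul t, abs_of_nonneg (hpos k)]
        _ ≤ _ := by gcongr; exact hC k
    obtain ⟨Ma, hMa, hMas⟩ := exists_multiplier hdense hortho (c := α)
      (C := |1| * (1 + C) + |0| * C) (fun k => by simpa [α] using hbd 1 0 k)
    obtain ⟨Mb, hMb, hMbs⟩ := exists_multiplier hdense hortho (c := β)
      (C := |0| * (1 + C) + |b| * C) (fun k => by simpa [β] using hbd 0 b k)
    have ela : ∀ k, l k * α k = 1 + (a * (l k - a) * (d k)⁻¹ + (-b ^ 2) * (d k)⁻¹) := by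
      intro k
      have : (1 : ℝ) = ((l k - a) ^ 2 + b ^ 2) * (d k)⁻¹ := (hdd k).symm
      rw [this]
      simp only [α]
      ring
    have elb : ∀ k, l k * β k = b * (l k - a) * (d k)⁻¹ + (a * b) * (d k)⁻¹ := by
      intro k
      simp only [β]
      ring
    obtain ⟨Na, hNa, hNas⟩ := exists_multiplier hdense hortho (c := fun k => l k * α k)
      (C := 1 + (|a| * (1 + C) + |(-b ^ 2)| * C)) (fun k => by
        simp only [ela]
        refine (abs_add_le _ _).trans ?_
        rw [abs_one]
        gcongr
        exact hbd _ _ k)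
    obtain ⟨Nb, hNb, hNbs⟩ := exists_multiplier hdense hortho (c := fun k => l k * β k)
      (C := |b| * (1 + C) + |a * b| * C) (fun k => by
        simp only [elb]
        exact hbd _ _ k)
    -- `id1` and `id2` are the real and imaginary parts of `(l k - z)(α k + iβ k) = 1`.
    have id1 : ∀ x, Na x - a • Ma x + b • Mb x = x := by
      intro x
      have : Na - a • Ma + b • Mb = ContinuousLinearMap.id ℝ H := by
        refine clm_eq_of_eqOn hdense fun k v hv => ?_
        have h1 : l k * α k - a * α k + b * β k = 1 := by
          rw [← hdd k]
          simp only [α, β, d]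
          ring
        simp only [add_apply, sub_apply, smul_apply, hNa k v hv, hMa k v hv, hMb k v hv,
          ContinuousLinearMap.id_apply, smul_smul, ← sub_smul, ← add_smul, h1, one_smul]
      simpa using congrArg (fun T : H →L[ℝ] H => T x) this
    have id2 : ∀ x, Nb x - a • Mb x - b • Ma x = 0 := by
      intro x
      have : Nb - a • Mb - b • Ma = 0 := by
        refine clm_eq_of_eqOn hdense fun k v hv => ?_
        have h1 : l k * β k - a * β k - b * α k = 0 := by
          simp only [α, β]
          ring
        simp only [sub_apply, smul_apply, hNb k v hv, hMa k v hv, hMb k v hv,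
          zero_apply, smul_smul, ← sub_smul, h1, zero_smul]
      simpa using congrArg (fun T : H →L[ℝ] H => T x) this
    let fst := ContinuousLinearMap.fst ℝ H H
    let snd := ContinuousLinearMap.snd ℝ H H
    refine ⟨(Ma ∘L fst - Mb ∘L snd).prod (Ma ∘L snd + Mb ∘L fst), fun u v => ?_, fun p => ?_⟩
    · have hu := (hgr _).2 (A.closure.mem_graph u)
      have hv := (hgr _).2 (A.closure.mem_graph v)
      have e1 := multiplier_of_mem_closure_graph hdense hsym hMa hNa hMas hNas hu
      have e2 := multiplier_of_mem_closure_graph hdense hsym hMa hNa hMas hNas hv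
      have e3 := multiplier_of_mem_closure_graph hdense hsym hMb hNb hMbs hNbs hu
      have e4 := multiplier_of_mem_closure_graph hdense hsym hMb hNb hMbs hNbs hv
      simp only at e1 e2 e3 e4
      have i1 := id1 (u : H)
      have i2 := id1 (v : H)
      have i3 := id2 (u : H)
      have i4 := id2 (v : H)
      refine Prod.ext ?_ ?_
      · simp only [fst, snd, ContinuousLinearMap.prod_apply, sub_apply,
          ContinuousLinearMap.comp_apply, ContinuousLinearMap.coe_fst',
          ContinuousLinearMap.coe_snd', map_add, map_sub, map_smul, e1, e4]
        calc _ = (Na (u : H) - a • Ma (u : H) + b • Mb (u : H)) -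
              (Nb (v : H) - a • Mb (v : H) - b • Ma (v : H)) := by abel
          _ = u := by rw [i1, i4, sub_zero]
      · simp only [fst, snd, ContinuousLinearMap.prod_apply, add_apply,
          ContinuousLinearMap.comp_apply, ContinuousLinearMap.coe_fst',
          ContinuousLinearMap.coe_snd', map_add, map_sub, map_smul, e2, e3]
        calc _ = (Na (v : H) - a • Ma (v : H) + b • Mb (v : H)) +
              (Nb (u : H) - a • Mb (u : H) - b • Ma (u : H)) := by abel
          _ = v := by rw [i2, i3, add_zero]
    · have hA : ∀ x, (Ma x, Na x) ∈ A.closure.graph := fun x =>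
        (hgr _).1 (mem_closure_graph_of_multiplier hdense hE hMa hNa x)
      have hB : ∀ x, (Mb x, Nb x) ∈ A.closure.graph := fun x =>
        (hgr _).1 (mem_closure_graph_of_multiplier hdense hE hMb hNb x)
      have h1 := A.closure.graph.sub_mem (hA p.1) (hB p.2)
      have h2 := A.closure.graph.add_mem (hA p.2) (hB p.1)
      obtain ⟨u, hu1, hu2⟩ := A.closure.mem_graph_iff.1 h1
      obtain ⟨v, hv1, hv2⟩ := A.closure.mem_graph_iff.1 h2
      simp only [Prod.fst_sub, Prod.snd_sub, Prod.fst_add, Prod.snd_add] at hu1 hu2 hv1 hv2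
      have i1 := id1 p.1
      have i2 := id1 p.2
      have i3 := id2 p.1
      have i4 := id2 p.2
      refine ⟨u, v, ?_, ?_⟩
      · rw [hu1, hv1]
        rfl
      · rw [hu1, hu2, hv1, hv2]
        refine Prod.ext ?_ ?_
        · simp only [smul_sub, smul_add]
          calc _ = (Na p.1 - a • Ma p.1 + b • Mb p.1) -
                (Nb p.2 - a • Mb p.2 - b • Ma p.2) := by abel
            _ = p.1 := by rw [i1, i4, sub_zero]
        · simp only [smul_sub, smul_add]
          calc _ = (Na p.2 - a • Ma p.2 + b • Mb p.2) +
                (Nb p.1 - a • Mb p.1 - b • Ma p.1) := by abel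
            _ = p.2 := by rw [i2, i3, add_zero]
  -- At an eigenvalue already the left inverse fails: it would send `0` to the nonzero vector `(v,
  -- 0)`.
  · rintro ⟨k, rfl⟩ ⟨R, hR, -⟩
    obtain ⟨v, hv, hv0⟩ := hne k
    have h1 : (v, l k • v) ∈ A.closure.graph :=
      (hgr _).1 (Submodule.le_topologicalClosure _ (hE k v hv))
    obtain ⟨u, hu1, hu2⟩ := A.closure.mem_graph_iff.1 h1
    simp only at hu1 hu2
    have h2 := hR u 0
    rw [hu1, hu2] at h2
    simp only [Complex.ofReal_re, Complex.ofReal_im, zero_smul, smul_zero, sub_self, add_zero,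
      ZeroMemClass.coe_zero] at h2
    have h3 : R ((0 : H), (0 : H)) = 0 := map_zero R
    rw [LinearPMap.map_zero, sub_zero, sub_zero, h3] at h2
    exact hv0 (congrArg Prod.fst h2).symm

end Operator

/-! ### Symmetry of the Laplace–Beltrami operator -/

section Green

open MeasureTheory Filter Topology

/-- Integration by parts against the constant `1`. -/
lemma integral_fderiv_eq_zero {V : Type*} [NormedAddCommGroup V] [NormedSpace ℝ V]
    [FiniteDimensional ℝ V] [MeasurableSpace V] [BorelSpace V] (μ : Measure V)
    [μ.IsAddHaarMeasure] {W : V → ℝ} (hW : ContDiff ℝ 1 W) (hc : HasCompactSupport W) (v : V) :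
    ∫ x, fderiv ℝ W x v ∂μ = 0 ∧ Integrable (fun x => fderiv ℝ W x v) μ := by
  have h1 : Continuous fun x => fderiv ℝ W x v :=
    (hW.continuous_fderiv (by norm_num)).clm_apply continuous_const
  have h2 : HasCompactSupport fun x => fderiv ℝ W x v := hc.fderiv_apply ℝ v
  have h3 : Integrable (fun x => fderiv ℝ W x v) μ := h1.integrable_of_hasCompactSupport h2
  have h4 : Integrable W μ := hW.continuous.integrable_of_hasCompactSupport hc
  have h := integral_mul_fderiv_eq_neg_fderiv_mul_of_integrable (μ := μ) (𝕜 := ℝ)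
    (f := fun _ => (1 : ℝ)) (g := W) (v := v) (by simp) (by simpa using h3) (by simpa using h4)
    (fun x _ => differentiableAt_const _)
    (fun x _ => (hW.differentiable (by norm_num)) x)
  refine ⟨?_, h3⟩
  simpa using h

variable {n : ℕ}

/-- Integration in polar coordinates of a product of a radial function and of a function of the
direction. -/
lemma integral_radial_mul (a : ℝ → ℝ) (b : Sph n → ℝ) {Q : Euc n → ℝ}
    (hQ : ∀ x : Euc n, (hx : x ≠ 0) → Q x = a ‖x‖ * b ⟨‖x‖⁻¹ • x, by simp [norm_smul, hx]⟩) :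
    ∫ x, Q x = (∫ w, b w ∂(volume : Measure (Euc n)).toSphere) *
      ∫ r : Set.Ioi (0 : ℝ), a r ∂(Measure.volumeIoiPow (Module.finrank ℝ (Euc n) - 1)) := by
  calc ∫ x, Q x = ∫ x : ({(0)}ᶜ : Set (Euc n)), Q x ∂((volume : Measure (Euc n)).comap (↑)) := by
        rw [integral_subtype_comap (measurableSet_singleton _).compl fun x ↦ Q x,
          restrict_compl_singleton]
    _ = ∫ p, b p.1 * a p.2 ∂((volume : Measure (Euc n)).toSphere.prod
          (Measure.volumeIoiPow (Module.finrank ℝ (Euc n) - 1))) := by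
        rw [← (volume : Measure (Euc n)).measurePreserving_homeomorphUnitSphereProd.integral_comp
          (Homeomorph.measurableEmbedding _)]
        refine integral_congr_ae (Eventually.of_forall fun x => ?_)
        simp only
        rw [hQ x x.2, mul_comm]
        congr 2
        · apply Subtype.ext
          simp
        · rw [homeomorphUnitSphereProd_apply_snd_coe]
    _ = _ := integral_prod_mul b fun r : Set.Ioi (0 : ℝ) => a r

lemma pd_pd_smul {F : Euc n → Cl n} (hF : ∀ r : ℝ, 0 < r → ∀ x, F (r • x) = F x)
    {r : ℝ} (hr : 0 < r) (i : Fin (n + 1)) (x : Euc n) :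
    pd i (pd i F) x = r ^ 2 • pd i (pd i F) (r • x) := by
  have h1 : ∀ y, pd i F y = r • pd i F (r • y) := by
    intro y
    have h : (fun z => F (r • z)) = F := funext fun z => hF r hr z
    have h2 := fderiv_comp_smul (𝕜 := ℝ) (f := F) (x := y) r
    simp only [h] at h2
    simp [pd, h2]
  have h3 : fderiv ℝ (pd i F) x = r • fderiv ℝ (fun y => pd i F (r • y)) x := by
    conv_lhs => rw [show pd i F = r • fun y => pd i F (r • y) from funext h1]
    exact congrFun (fderiv_const_smul_field (𝕜 := ℝ) (F := Cl n) r) x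
  have h4 := fderiv_comp_smul (𝕜 := ℝ) (f := pd i F) (x := x) r
  change fderiv ℝ (pd i F) x _ = r ^ 2 • fderiv ℝ (pd i F) (r • x) _
  rw [h3, h4, smul_smul, ← pow_two]
  rfl

lemma sum_pd_pd_radialExt {f : Sph n → Cl n} (hf : ContMDiff (𝓡 n) 𝓘(ℝ, Cl n) 2 f)
    {x : Euc n} (hx : x ≠ 0) :
    ∑ i, pd i (pd i (radialExt f)) x =
      (‖x‖⁻¹ ^ 2) • beltramiS f ⟨‖x‖⁻¹ • x, by simp [norm_smul, hx]⟩ := by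
  have hr : 0 < ‖x‖⁻¹ := inv_pos.2 (norm_pos_iff.2 hx)
  rw [beltramiS, laplacian_eq_sum_pd (contDiffAt_two_radialExt hf (sph_ne_zero _)),
    Finset.smul_sum]
  exact Finset.sum_congr rfl fun i _ =>
    pd_pd_smul (fun r hr x => radialExt_smul f hr x) hr i x

lemma contDiffAt_pd {F : Euc n → Cl n} {x : Euc n} (i : Fin (n + 1))
    (hF : ContDiffAt ℝ 2 F x) : ContDiffAt ℝ 1 (pd i F) x :=
  (hF.fderiv_right (m := 1) (by norm_num)).clm_apply contDiffAt_const

/-- Green's identity is pulled back to `ℝ^{n+1}`. The field `φ(⟨∂_iF, G⟩ - ⟨F, ∂_iG⟩)`, with a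
radial cutoff `φ` vanishing near `0`, has a divergence of integral zero. The gradient of `φ` is
radial and so meets only `EF = EG = 0`. Polar coordinates then split the integral into the spherical
one and a positive radial factor. -/
theorem integral_inner_beltramiS {f g : Sph n → Cl n} (hf : ContMDiff (𝓡 n) 𝓘(ℝ, Cl n) 2 f)
    (hg : ContMDiff (𝓡 n) 𝓘(ℝ, Cl n) 2 g) :
    ∫ w, (inner ℝ (beltramiS f w) (g w) - inner ℝ (f w) (beltramiS g w))
      ∂(volume : Measure (Euc n)).toSphere = 0 := by
  let ψ : ContDiffBump (1 : ℝ) := ⟨1 / 4, 1 / 2, by norm_num, by norm_num⟩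
  have hψ0 : ∀ t : ℝ, 1 / 2 ≤ dist t 1 → ψ t = 0 := fun t ht => ψ.zero_of_le_dist ht
  -- The factor `‖x‖ ^ 2` cancels the degree `-2` of `ΔF` and `ΔG`, leaving a product of a radial
  -- function and a function of the direction.
  let φ : Euc n → ℝ := fun x => ‖x‖ ^ 2 * ψ (‖x‖ ^ 2)
  have hψn : ContDiff ℝ ∞ fun x : Euc n => ψ (‖x‖ ^ 2) :=
    ψ.contDiff.comp (contDiff_norm_sq ℝ)
  have hφ : ContDiff ℝ ∞ φ := (contDiff_norm_sq ℝ).mul hψn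
  have hfar : ∀ x : Euc n, x ∉ Metric.closedBall (0 : Euc n) 2 → ψ (‖x‖ ^ 2) = 0 := by
    intro x hx
    have hx' : 2 < ‖x‖ := by simpa using hx
    apply hψ0
    rw [Real.dist_eq]
    exact le_trans (by nlinarith) (le_abs_self _)
  have hcψ : HasCompactSupport fun x : Euc n => ψ (‖x‖ ^ 2) :=
    HasCompactSupport.intro (isCompact_closedBall 0 2) hfar
  have hcφ : HasCompactSupport φ := hcψ.mul_left
  have hnear : φ =ᶠ[𝓝 (0 : Euc n)] fun _ => 0 := by
    filter_upwards [Metric.ball_mem_nhds (0 : Euc n) (by norm_num : (0 : ℝ) < 1 / 2)] with x hx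
    have hx' : ‖x‖ < 1 / 2 := by simpa using hx
    have : ψ (‖x‖ ^ 2) = 0 := by
      apply hψ0
      rw [Real.dist_eq, abs_sub_comm]
      exact le_trans (by nlinarith [norm_nonneg x]) (le_abs_self _)
    simp [φ, this]
  let k : Euc n → ℝ := fun x => 2 * deriv (fun t => t * ψ t) (‖x‖ ^ 2)
  have hdφ : ∀ (x : Euc n) (i : Fin (n + 1)),
      fderiv ℝ φ x (EuclideanSpace.single i 1) = k x * x i := by
    intro x i
    have h1 : DifferentiableAt ℝ (fun t => t * ψ t) (‖x‖ ^ 2) :=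
      (differentiable_id.mul (ψ.contDiff (n := 1) |>.differentiable (by norm_num))) _
    have h2 : HasFDerivAt (fun y : Euc n => ‖y‖ ^ 2) (2 • innerSL ℝ x) x :=
      (hasStrictFDerivAt_norm_sq x).hasFDerivAt
    have h3 := HasDerivAt.comp_hasFDerivAt (h₂ := fun t => t * ψ t) x h1.hasDerivAt h2
    have h4 : fderiv ℝ φ x = _ := h3.fderiv
    rw [h4]
    simp [k, EuclideanSpace.inner_single_right]
    ring
  let F := radialExt f
  let G := radialExt g
  have hF : ∀ x : Euc n, x ≠ 0 → ContDiffAt ℝ 2 F x := fun x hx => contDiffAt_two_radialExt hf hx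
  have hG : ∀ x : Euc n, x ≠ 0 → ContDiffAt ℝ 2 G x := fun x hx => contDiffAt_two_radialExt hg hx
  let B : Fin (n + 1) → Euc n → ℝ := fun i x => inner ℝ (pd i F x) (G x) - inner ℝ (F x) (pd i G x)
  let W : Fin (n + 1) → Euc n → ℝ := fun i x => φ x * B i x
  have hB : ∀ i (x : Euc n), x ≠ 0 → ContDiffAt ℝ 1 (B i) x := fun i x hx =>
    ((contDiffAt_pd i (hF x hx)).inner ℝ ((hG x hx).of_le (by norm_num))).sub
      (((hF x hx).of_le (by norm_num)).inner ℝ (contDiffAt_pd i (hG x hx)))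
  have hW0 : ∀ i, W i =ᶠ[𝓝 (0 : Euc n)] fun _ => 0 := fun i => by
    filter_upwards [hnear] with x hx
    simp [W, hx]
  have hW : ∀ i, ContDiff ℝ 1 (W i) := by
    intro i
    rw [contDiff_iff_contDiffAt]
    intro x
    by_cases hx : x = 0
    · subst hx
      exact contDiffAt_const.congr_of_eventuallyEq (hW0 i)
    · exact ((hφ.of_le (by exact_mod_cast le_top)).contDiffAt).mul (hB i x hx)
  have hWc : ∀ i, HasCompactSupport (W i) := fun i => hcφ.mul_right
  have hint := fun i : Fin (n + 1) => integral_fderiv_eq_zero (volume : Measure (Euc n))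
    (hW i) (hWc i) (EuclideanSpace.single i (1 : ℝ))
  have hsum : ∫ x, ∑ i, fderiv ℝ (W i) x (EuclideanSpace.single i 1) = 0 := by
    rw [integral_finsetSum _ fun i _ => (hint i).2]
    exact Finset.sum_eq_zero fun i _ => (hint i).1
  have hdB : ∀ i (x : Euc n), x ≠ 0 → fderiv ℝ (B i) x (EuclideanSpace.single i 1) =
      inner ℝ (pd i (pd i F) x) (G x) - inner ℝ (F x) (pd i (pd i G) x) := by
    intro i x hx
    have d1 : DifferentiableAt ℝ F x := (hF x hx).differentiableAt (by norm_num)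
    have d2 : DifferentiableAt ℝ G x := (hG x hx).differentiableAt (by norm_num)
    have d3 := differentiableAt_pd i (hF x hx)
    have d4 := differentiableAt_pd i (hG x hx)
    rw [fderiv_fun_sub (d3.inner ℝ d2) (d1.inner ℝ d4), sub_apply, fderiv_inner_apply ℝ d3 d2,
      fderiv_inner_apply ℝ d1 d4]
    simp only [← pd.eq_def]
    ring
  have hpt : ∀ x : Euc n, (hx : x ≠ 0) →
      ∑ i, fderiv ℝ (W i) x (EuclideanSpace.single i 1) = ψ (‖x‖ ^ 2) *
        (fun w : Sph n => inner ℝ (beltramiS f w) (g w) - inner ℝ (f w) (beltramiS g w))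
          ⟨‖x‖⁻¹ • x, by simp [norm_smul, hx]⟩ := by
    intro x hx
    have h1 : ∀ i, fderiv ℝ (W i) x (EuclideanSpace.single i 1) =
        φ x * (inner ℝ (pd i (pd i F) x) (G x) - inner ℝ (F x) (pd i (pd i G) x)) +
          k x * (inner ℝ (x i • pd i F x) (G x) - inner ℝ (F x) (x i • pd i G x)) := by
      intro i
      rw [fderiv_fun_mul ((hφ.differentiable (by simp)) x)
        ((hB i x hx).differentiableAt (by norm_num)), add_apply, smul_apply, smul_apply, hdB i x hx,
        hdφ, real_inner_smul_left, real_inner_smul_right]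
      simp only [smul_eq_mul, B]
      ring
    simp only [h1, Finset.sum_add_distrib, ← Finset.mul_sum, Finset.sum_sub_distrib,
      ← sum_inner, ← inner_sum]
    have e1 : ∑ i, x i • pd i F x = 0 := euler_radialExt f x
    have e2 : ∑ i, x i • pd i G x = 0 := euler_radialExt g x
    have e3 : ∑ i, pd i (pd i F) x = _ := sum_pd_pd_radialExt hf hx
    have e4 : ∑ i, pd i (pd i G) x = _ := sum_pd_pd_radialExt hg hx
    have hFx : F x = f ⟨‖x‖⁻¹ • x, by simp [norm_smul, hx]⟩ := dif_pos hx
    have hGx : G x = g ⟨‖x‖⁻¹ • x, by simp [norm_smul, hx]⟩ := dif_pos hx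
    rw [e1, e2, e3, e4, hFx, hGx, real_inner_smul_left, real_inner_smul_right]
    simp only [inner_zero_left, inner_zero_right, sub_self, mul_zero, add_zero, φ]
    have : ‖x‖ ≠ 0 := norm_ne_zero_iff.2 hx
    field_simp
  have key := integral_radial_mul (fun r => ψ (r ^ 2))
    (fun w : Sph n => inner ℝ (beltramiS f w) (g w) - inner ℝ (f w) (beltramiS g w))
    (Q := fun x => ∑ i, fderiv ℝ (W i) x (EuclideanSpace.single i 1)) hpt
  rw [hsum] at key
  -- The same radial integral with angular part `1` is a factor of a positive number, hence nonzero.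
  have hone := integral_radial_mul (n := n) (fun r => ψ (r ^ 2)) (fun _ => 1)
    (Q := fun x => ψ (‖x‖ ^ 2)) (fun x hx => by simp)
  have hpos : 0 < ∫ x : Euc n, ψ (‖x‖ ^ 2) := by
    refine hψn.continuous.integral_pos_of_hasCompactSupport_nonneg_nonzero hcψ
      (fun x => ψ.nonneg) (x := EuclideanSpace.single 0 1) ?_
    have : ψ (1 : ℝ) = 1 := ψ.one_of_mem_closedBall (Metric.mem_closedBall_self ψ.rIn_pos.le)
    simp [this]
  rw [hone] at hpos
  exact (mul_eq_zero.1 key.symm).resolve_right (right_ne_zero_of_mul hpos.ne')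

end Green

/-! ### Eigenfunctions of the spherical Laplacian -/

section Eigen

open MeasureTheory Filter Topology

variable {n : ℕ}

/-- The smooth eigenfunctions of `Δ_s` for the eigenvalue `eigenval n k`. -/
def eigenSmooth (n k : ℕ) : Submodule ℝ (SmoothS n) :=
  LinearMap.ker (laplaceToCont n - eigenval n k • smoothToCont n)

lemma mem_eigenSmooth {k : ℕ} {f : SmoothS n} :
    f ∈ eigenSmooth n k ↔ laplaceToCont n f = eigenval n k • smoothToCont n f := by
  rw [eigenSmooth, LinearMap.mem_ker, LinearMap.sub_apply, sub_eq_zero]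
  rfl

/-- The difference factors as `(k - m)(k + m + n - 1)`; for `n ≥ 1` the second factor vanishes only
if `k = m = 0`. -/
lemma eigenval_injective (hn : 1 ≤ n) : Function.Injective (eigenval n) := by
  intro k m h
  have hn' : (1 : ℝ) ≤ n := by exact_mod_cast hn
  have h1 : ((k : ℝ) - m) * ((k : ℝ) + m + (n - 1)) = 0 := by
    simp only [eigenval] at h
    linarith
  have hk : (0 : ℝ) ≤ k := Nat.cast_nonneg k
  have hm : (0 : ℝ) ≤ m := Nat.cast_nonneg m
  rcases mul_eq_zero.1 h1 with h2 | h2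
  · exact_mod_cast sub_eq_zero.1 h2
  · have h3 : (k : ℝ) = 0 := by linarith
    have h4 : (m : ℝ) = 0 := by linarith
    exact_mod_cast h3.trans h4.symm

lemma tendsto_eigenval (hn : 1 ≤ n) : Tendsto (eigenval n) atTop atBot := by
  have hn' : (1 : ℝ) ≤ n := by exact_mod_cast hn
  have h : Tendsto (fun m : ℕ => -(m : ℝ) + -((n : ℝ) ^ 2 / 4 - (n : ℝ) / 2)) atTop atBot :=
    tendsto_atBot_add_const_right _ _ (tendsto_neg_atTop_atBot.comp tendsto_natCast_atTop_atTop)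
  refine tendsto_atBot_mono (fun m => ?_) h
  have h1 : (m : ℝ) ≤ (m : ℝ) ^ 2 := by
    exact_mod_cast Nat.le_self_pow two_ne_zero m
  have h2 : 0 ≤ (m : ℝ) * ((n : ℝ) - 1) := mul_nonneg (Nat.cast_nonneg m) (by linarith)
  simp only [eigenval]
  linarith

/-- The restriction to the sphere of a `Cl_n`-valued polynomial. -/
def polySmooth (n : ℕ) :
    (Finset (Fin n) → MvPolynomial (Fin (n + 1)) ℝ) →ₗ[ℝ] SmoothS n where
  toFun P := ⟨fun w => polyFun P w, contMDiff_polyFun P⟩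
  map_add' P Q := by
    ext w
    change polyFun (P + Q) (w : Euc n) = polyFun P (w : Euc n) + polyFun Q (w : Euc n)
    simp [polyFun, polyEval, add_smul, Finset.sum_add_distrib]
  map_smul' r P := by
    ext w
    change polyFun (r • P) (w : Euc n) = r • polyFun P (w : Euc n)
    simp [polyFun, polyEval, mul_smul, Finset.smul_sum]

lemma laplaceToCont_polySmooth {P : Finset (Fin n) → MvPolynomial (Fin (n + 1)) ℝ} {m : ℕ}
    (hP : ∀ A, (P A).IsHomogeneous m) :
    laplaceToCont n (polySmooth n P) = smoothToCont n (polySmooth n (polyLap P)) +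
      eigenval n m • smoothToCont n (polySmooth n P) :=
  ContinuousMap.ext fun w => laplaceS_polyFun hP w

lemma polyLap_isHomogeneous {P : Finset (Fin n) → MvPolynomial (Fin (n + 1)) ℝ} {m : ℕ}
    (hP : ∀ A, (P A).IsHomogeneous m) (A : Finset (Fin n)) :
    (polyLap P A).IsHomogeneous (m - 1 - 1) :=
  MvPolynomial.IsHomogeneous.sum _ _ _ fun _ _ => (hP A).pderiv.pderiv

lemma polyLap_eq_zero {P : Finset (Fin n) → MvPolynomial (Fin (n + 1)) ℝ}
    (hP : ∀ A, (P A).IsHomogeneous 0) : polyLap P = 0 := by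
  funext A
  have h := MvPolynomial.totalDegree_eq_zero_iff_eq_C.1
    ((MvPolynomial.totalDegree_zero_iff_isHomogeneous _).2 (hP A))
  simp only [polyLap]
  rw [h]
  simp

/-- The sum of the eigenspaces of index less than `m`. -/
def eigenBelow (n m : ℕ) : Submodule ℝ (SmoothS n) := ⨆ k, ⨆ _ : k < m, eigenSmooth n k

lemma eigenSmooth_le_eigenBelow {k m : ℕ} (h : k < m) : eigenSmooth n k ≤ eigenBelow n m :=
  le_iSup₂_of_le k h le_rfl

lemma eigenBelow_mono {k m : ℕ} (h : k ≤ m) : eigenBelow n k ≤ eigenBelow n m :=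
  iSup₂_le fun _ hj => eigenSmooth_le_eigenBelow (hj.trans_le h)

/-- `Δ_s - λ_m` maps the sum of the eigenspaces of index less than `m` onto itself. -/
lemma exists_solution (hn : 1 ≤ n) {m : ℕ} {g : SmoothS n} (hg : g ∈ eigenBelow n m) :
    ∃ g' ∈ eigenBelow n m,
      (laplaceToCont n - eigenval n m • smoothToCont n) g' = smoothToCont n g := by
  have h : (eigenBelow n m).map (smoothToCont n) ≤
      (eigenBelow n m).map (laplaceToCont n - eigenval n m • smoothToCont n) := by
    rw [Submodule.map_le_iff_le_comap]
    -- On the eigenspace of index `k < m` the operator is the nonzero scalar `λ_k - λ_m`.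
    refine iSup₂_le fun k hk f hf => ?_
    have hne : eigenval n k - eigenval n m ≠ 0 :=
      sub_ne_zero.2 ((eigenval_injective hn).ne hk.ne)
    refine ⟨(eigenval n k - eigenval n m)⁻¹ • f,
      Submodule.smul_mem _ _ (eigenSmooth_le_eigenBelow hk hf), ?_⟩
    rw [map_smul, LinearMap.sub_apply, mem_eigenSmooth.1 hf, LinearMap.smul_apply, ← sub_smul,
      smul_smul, inv_mul_cancel₀ hne, one_smul]
  exact h (Submodule.mem_map_of_mem hg)

/-- `Δ_s - λ_m` sends `P` to `ΔP` on the sphere, which by induction lies in the lower eigenspaces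
and so equals `(Δ_s - λ_m)g` with `g` in them. Then `P - g` is an eigenfunction for `λ_m`. This
replaces the decomposition of `P` into terms `|x|^{2j} H_j`. -/
lemma polySmooth_mem_eigenBelow (hn : 1 ≤ n) (m : ℕ) :
    ∀ P : Finset (Fin n) → MvPolynomial (Fin (n + 1)) ℝ, (∀ A, (P A).IsHomogeneous m) →
      polySmooth n P ∈ eigenBelow n (m + 1) := by
  induction m using Nat.strong_induction_on with
  | _ m ih =>
    intro P hP
    have hL : polySmooth n (polyLap P) ∈ eigenBelow n m := by
      -- Because `m - 1 - 1` is truncated, it is smaller than `m` only for `m > 0`; for constants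
      -- the Laplacian vanishes.
      rcases Nat.eq_zero_or_pos m with rfl | hm
      · rw [polyLap_eq_zero hP, map_zero]
        exact Submodule.zero_mem _
      · exact eigenBelow_mono (by omega) (ih (m - 1 - 1) (by omega) _ (polyLap_isHomogeneous hP))
    obtain ⟨g, hg, hg'⟩ := exists_solution hn hL
    have h1 : (laplaceToCont n - eigenval n m • smoothToCont n) (polySmooth n P) =
        smoothToCont n (polySmooth n (polyLap P)) := by
      rw [LinearMap.sub_apply, laplaceToCont_polySmooth hP, LinearMap.smul_apply,
        add_sub_cancel_right]
    have h2 : polySmooth n P - g ∈ eigenSmooth n m := by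
      rw [eigenSmooth, LinearMap.mem_ker, map_sub, h1, hg', sub_self]
    have h3 := Submodule.add_mem _ (eigenSmooth_le_eigenBelow (Nat.lt_succ_self m) h2)
      (eigenBelow_mono (Nat.le_succ m) hg)
    rwa [sub_add_cancel] at h3

lemma polySmooth_mem_iSup (hn : 1 ≤ n) (P : Finset (Fin n) → MvPolynomial (Fin (n + 1)) ℝ) :
    polySmooth n P ∈ ⨆ k, eigenSmooth n k := by
  classical
  have h0 : ∀ m, eigenBelow n m ≤ ⨆ k, eigenSmooth n k :=
    fun m => iSup₂_le fun k _ => le_iSup (eigenSmooth n) k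
  rw [← Finset.univ_sum_single P, map_sum]
  refine Submodule.sum_mem _ fun A _ => ?_
  rw [← MvPolynomial.sum_homogeneousComponent (P A)]
  have h1 : ∀ s : Finset ℕ, Pi.single A (∑ i ∈ s, MvPolynomial.homogeneousComponent i (P A)) =
      ∑ i ∈ s, (Pi.single A (MvPolynomial.homogeneousComponent i (P A)) :
        Finset (Fin n) → MvPolynomial (Fin (n + 1)) ℝ) :=
    fun s => map_sum (AddMonoidHom.single (fun _ => MvPolynomial (Fin (n + 1)) ℝ) A) _ s
  rw [h1, map_sum]
  refine Submodule.sum_mem _ fun m _ => h0 (m + 1) (polySmooth_mem_eigenBelow hn m _ fun B => ?_)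
  by_cases hB : B = A
  · subst hB
    rw [Pi.single_eq_same]
    exact MvPolynomial.homogeneousComponent_isHomogeneous m _
  · rw [Pi.single_eq_of_ne hB]
    exact MvPolynomial.isHomogeneous_zero _ _ _

/-! ### Density of the polynomials -/

/-- Restriction of the polynomials to the sphere. -/
def polyAlg (n : ℕ) : MvPolynomial (Fin (n + 1)) ℝ →ₐ[ℝ] C(Sph n, ℝ) :=
  MvPolynomial.aeval fun i => ⟨fun w => (w : Euc n) i, by fun_prop⟩

lemma polyAlg_apply (P : MvPolynomial (Fin (n + 1)) ℝ) (w : Sph n) :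
    polyAlg n P w = polyEval P (w : Euc n) := by
  induction P using MvPolynomial.induction_on with
  | C a => simp [polyAlg, polyEval]
  | add p q hp hq => rw [map_add, ContinuousMap.add_apply, hp, hq]; simp [polyEval]
  | mul_X p i hp =>
    rw [map_mul, ContinuousMap.mul_apply, hp]
    simp [polyAlg, polyEval]

lemma polyAlg_dense (n : ℕ) : (polyAlg n).range.topologicalClosure = ⊤ := by
  refine ContinuousMap.subalgebra_topologicalClosure_eq_top_of_separatesPoints _ ?_
  intro v w hvw
  obtain ⟨i, hi⟩ : ∃ i, (v : Euc n) i ≠ (w : Euc n) i := by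
    by_contra h
    push Not at h
    exact hvw (Subtype.ext (PiLp.ext h))
  refine ⟨polyAlg n (MvPolynomial.X i), ⟨_, ⟨MvPolynomial.X i, rfl⟩, rfl⟩, ?_⟩
  simpa [polyAlg_apply, polyEval] using hi

/-- Stone–Weierstrass is applied to each coordinate in the basis `e_A`, giving density already in
the uniform norm. -/
lemma dense_map_smoothToCont (hn : 1 ≤ n) :
    Dense (((⨆ k, eigenSmooth n k).map (smoothToCont n) : Submodule ℝ C(Sph n, Cl n)) :
      Set C(Sph n, Cl n)) := by
  classical
  rw [Submodule.dense_iff_topologicalClosure_eq_top, eq_top_iff]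
  intro f _
  set K := ((⨆ k, eigenSmooth n k).map (smoothToCont n)).topologicalClosure with hK
  let S : Finset (Fin n) → C(Sph n, ℝ) →L[ℝ] C(Sph n, Cl n) := fun A =>
    ((ContinuousLinearMap.id ℝ ℝ).smulRight (clBasis n A)).compLeftContinuous ℝ (Sph n)
  have hS : ∀ A g w, S A g w = g w • clBasis n A := fun A g w => rfl
  have h1 : ∀ A g, S A g ∈ K := by
    intro A g
    have hcl : IsClosed (S A ⁻¹' (K : Set C(Sph n, Cl n))) :=
      (Submodule.isClosed_topologicalClosure _).preimage (S A).continuous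
    have hsub : ((polyAlg n).range : Set C(Sph n, ℝ)) ⊆ S A ⁻¹' (K : Set C(Sph n, Cl n)) := by
      rintro _ ⟨P, rfl⟩
      refine Submodule.le_topologicalClosure _
        ⟨polySmooth n (Pi.single A P), polySmooth_mem_iSup hn _, ?_⟩
      refine ContinuousMap.ext fun w => ?_
      change polyFun (Pi.single A P) (w : Euc n) = polyAlg n P w • clBasis n A
      rw [polyAlg_apply, polyFun, Finset.sum_eq_single A]
      · simp
      · intro B _ hB
        simp [Pi.single_eq_of_ne hB, polyEval]
      · simp
    have h2 : g ∈ (polyAlg n).range.topologicalClosure := by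
      rw [polyAlg_dense]; exact Algebra.mem_top
    exact closure_minimal hsub hcl h2
  have h3 : f = ∑ A, S A ⟨fun w => (clBasis n).repr (f w) A,
      ((LinearMap.toContinuousLinearMap ((clBasis n).coord A)).continuous).comp f.continuous⟩ := by
    refine ContinuousMap.ext fun w => ?_
    rw [ContinuousMap.sum_apply]
    simp only [hS]
    exact ((clBasis n).sum_repr (f w)).symm
  rw [h3]
  exact Submodule.sum_mem _ fun A _ => h1 A _

/-- The image in `L²` of the smooth eigenfunctions. -/
def eigenL2 (n k : ℕ) : Submodule ℝ (L2S n) := (eigenSmooth n k).map (smoothToL2 n)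

lemma iSup_eigenL2_dense (hn : 1 ≤ n) : (⨆ k, eigenL2 n k).topologicalClosure = ⊤ := by
  rw [← Submodule.dense_iff_topologicalClosure_eq_top]
  have h1 := (ContinuousMap.toLp_denseRange (Cl n) (volume : Measure (Euc n)).toSphere ℝ
    (p := 2) (by norm_num)).dense_image
      (ContinuousLinearMap.continuous _) (dense_map_smoothToCont hn)
  have h2 : (⨆ k, eigenL2 n k) =
      ((⨆ k, eigenSmooth n k).map (smoothToCont n)).map (contToL2 n) := by
    rw [← Submodule.map_comp, Submodule.map_iSup]
    rfl
  rw [h2]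
  exact h1

/-! ### The graph of `Δ_s` -/

lemma mem_laplacePMap_graph {p : L2S n × L2S n} :
    p ∈ (laplacePMap n).graph ↔
      ∃ f : SmoothS n, smoothToL2 n f = p.1 ∧ contToL2 n (laplaceToCont n f) = p.2 := by
  have key : ∀ (f : SmoothS n) (h : smoothToL2 n f ∈ (laplacePMap n).domain),
      laplacePMap n ⟨smoothToL2 n f, h⟩ = contToL2 n (laplaceToCont n f) := by
    intro f h
    change contToL2 n (laplaceToCont n
      ((LinearEquiv.ofInjective (smoothToL2 n) (smoothToL2_injective n)).symm _)) = _
    congr 2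
    exact (LinearEquiv.ofInjective (smoothToL2 n) (smoothToL2_injective n)).symm_apply_apply f
  rw [LinearPMap.mem_graph_iff]
  constructor
  · rintro ⟨⟨_, f, rfl⟩, h1, h2⟩
    exact ⟨f, h1, (key f _).symm.trans h2⟩
  · rintro ⟨f, h1, h2⟩
    exact ⟨⟨smoothToL2 n f, f, rfl⟩, h1, (key f _).trans h2⟩

lemma eigenL2_mem_graph (k : ℕ) {v : L2S n} (hv : v ∈ eigenL2 n k) :
    (v, eigenval n k • v) ∈ (laplacePMap n).graph := by
  obtain ⟨f, hf, rfl⟩ := hv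
  refine mem_laplacePMap_graph.2 ⟨f, rfl, ?_⟩
  rw [mem_eigenSmooth.1 hf, map_smul]
  rfl

lemma inner_contToL2 (f g : C(Sph n, Cl n)) :
    inner ℝ (contToL2 n f) (contToL2 n g) =
      ∫ w, inner ℝ (f w) (g w) ∂(volume : Measure (Euc n)).toSphere := by
  rw [L2.inner_def]
  refine integral_congr_ae ?_
  filter_upwards [ContinuousMap.coeFn_toLp (p := 2) (𝕜 := ℝ)
    (volume : Measure (Euc n)).toSphere f, ContinuousMap.coeFn_toLp (p := 2) (𝕜 := ℝ)
    (volume : Measure (Euc n)).toSphere g] with w hf hg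
  exact congrArg₂ (inner ℝ) hf hg

lemma inner_laplace (f g : SmoothS n) :
    inner ℝ (contToL2 n (laplaceToCont n f)) (smoothToL2 n g) =
      inner ℝ (smoothToL2 n f) (contToL2 n (laplaceToCont n g)) := by
  change inner ℝ _ (contToL2 n (smoothToCont n g)) = inner ℝ (contToL2 n (smoothToCont n f)) _
  rw [inner_contToL2, inner_contToL2, ← sub_eq_zero, ← integral_sub,
    ← integral_inner_beltramiS f.contMDiff_two g.contMDiff_two]
  · refine integral_congr_ae (Eventually.of_forall fun w => ?_)
    change inner ℝ (laplaceS f w) (g w) - inner ℝ (f w) (laplaceS g w) = _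
    simp only [laplaceS, Pi.sub_apply, Pi.smul_apply, inner_sub_left, inner_sub_right,
      real_inner_smul_left, real_inner_smul_right]
    ring
  · exact Continuous.integrable_of_hasCompactSupport
      ((ContinuousMap.continuous _).inner (ContinuousMap.continuous _))
      (HasCompactSupport.of_compactSpace _)
  · exact Continuous.integrable_of_hasCompactSupport
      ((ContinuousMap.continuous _).inner (ContinuousMap.continuous _))
      (HasCompactSupport.of_compactSpace _)

lemma laplacePMap_symmetric {p : L2S n × L2S n} (hp : p ∈ (laplacePMap n).graph) (k : ℕ)
    {v : L2S n} (hv : v ∈ eigenL2 n k) : inner ℝ p.2 v = eigenval n k * inner ℝ p.1 v := by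
  obtain ⟨f, h1, h2⟩ := mem_laplacePMap_graph.1 hp
  obtain ⟨g, hg, rfl⟩ := hv
  rw [← h1, ← h2, inner_laplace, mem_eigenSmooth.1 hg, map_smul, real_inner_smul_right]
  rfl

/-! ### Existence of spherical harmonics -/

/-- The commutator of two derivations is a derivation, and this one kills the variables. -/
lemma pderiv_comm (i j : Fin (n + 1)) (P : MvPolynomial (Fin (n + 1)) ℝ) :
    MvPolynomial.pderiv i (MvPolynomial.pderiv j P) =
      MvPolynomial.pderiv j (MvPolynomial.pderiv i P) := by
  have h : ⁅(MvPolynomial.pderiv i : Derivation ℝ (MvPolynomial (Fin (n + 1)) ℝ)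
      (MvPolynomial (Fin (n + 1)) ℝ)), MvPolynomial.pderiv (R := ℝ) j⁆ = 0 := by
    refine MvPolynomial.derivation_ext fun k => ?_
    simp [Derivation.commutator_apply, MvPolynomial.pderiv_X, Pi.single_apply, apply_ite]
  have h2 := congrArg (fun D : Derivation ℝ (MvPolynomial (Fin (n + 1)) ℝ)
    (MvPolynomial (Fin (n + 1)) ℝ) => D P) h
  rw [Derivation.commutator_apply, Derivation.zero_apply, sub_eq_zero] at h2
  exact h2

open MvPolynomial in
/-- The real and imaginary parts of `(x₀ + i xₙ)^m`. -/
lemma exists_cauchyRiemann (hn : 1 ≤ n) (m : ℕ) : ∃ a b : MvPolynomial (Fin (n + 1)) ℝ,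
    a.IsHomogeneous m ∧ b.IsHomogeneous m ∧
    pderiv 0 a = pderiv (Fin.last n) b ∧ pderiv (Fin.last n) a = -pderiv 0 b ∧
    (∀ i, i ≠ 0 → i ≠ Fin.last n → pderiv i a = 0 ∧ pderiv i b = 0) ∧
    polyEval a (EuclideanSpace.single 0 1) = 1 ∧ polyEval b (EuclideanSpace.single 0 1) = 0 := by
  have hne : (0 : Fin (n + 1)) ≠ Fin.last n := fun h => by
    have := congrArg Fin.val h
    simp at this
    omega
  induction m with
  | zero =>
    refine ⟨1, 0, isHomogeneous_one _ _, isHomogeneous_zero _ _ _, ?_⟩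
    simp [polyEval]
  | succ m ih =>
    obtain ⟨a, b, ha, hb, h1, h2, h3, h4, h5⟩ := ih
    have hX : ∀ (i : Fin (n + 1)) {p : MvPolynomial (Fin (n + 1)) ℝ}, p.IsHomogeneous m →
        (X i * p).IsHomogeneous (m + 1) := fun i p hp => by
      have h := (isHomogeneous_X ℝ i).mul hp
      rwa [add_comm 1 m] at h
    -- Multiplication of `a + ib` by `x₀ + i xₙ`; the two variables differ because `n ≥ 1`.
    refine ⟨X 0 * a - X (Fin.last n) * b, X 0 * b + X (Fin.last n) * a, (hX 0 ha).sub (hX _ hb),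
      (hX 0 hb).add (hX _ ha), ?_, ?_, ?_, ?_, ?_⟩
    · simp [Derivation.leibniz, pderiv_X, hne, hne.symm, h1, h2]
      ring
    · simp [Derivation.leibniz, pderiv_X, hne, hne.symm, h1, h2]
      ring
    · intro i hi hi'
      simp [Derivation.leibniz, pderiv_X, hi.symm, hi'.symm, (h3 i hi hi').1, (h3 i hi hi').2]
    · simp only [polyEval] at h4 h5 ⊢
      simp only [map_sub, map_mul, eval_X, h4, h5]
      simp
    · simp only [polyEval] at h4 h5 ⊢
      simp only [map_add, map_mul, eval_X, h4, h5]
      simp [hne.symm]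

/-- The witness is `Re (x₀ + i xₙ)^m e_∅`: harmonic by the Cauchy–Riemann equations, and nonzero
because it equals `e_∅` at the point `(1, 0, …, 0)`. -/
lemma exists_ne_zero_mem_eigenL2 (hn : 1 ≤ n) (m : ℕ) : ∃ v ∈ eigenL2 n m, v ≠ 0 := by
  classical
  obtain ⟨a, b, ha, -, h1, h2, h3, h4, -⟩ := exists_cauchyRiemann hn m
  have hne : (0 : Fin (n + 1)) ≠ Fin.last n := fun h => by
    have := congrArg Fin.val h
    simp at this
    omega
  let P : Finset (Fin n) → MvPolynomial (Fin (n + 1)) ℝ := Pi.single ∅ a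
  have hPh : ∀ A, (P A).IsHomogeneous m := by
    intro A
    by_cases hA : A = ∅
    · subst hA; simpa [P] using ha
    · simpa [P, Pi.single_eq_of_ne hA] using MvPolynomial.isHomogeneous_zero _ _ _
  have hlap : ∑ i, MvPolynomial.pderiv i (MvPolynomial.pderiv i a) = 0 := by
    rw [Finset.sum_eq_add 0 (Fin.last n) hne
      (fun i _ hi => by rw [(h3 i hi.1 hi.2).1, map_zero]) (by simp) (by simp), h1, h2, map_neg,
      pderiv_comm, add_neg_cancel]
  have hL : polyLap P = 0 := by
    funext A
    by_cases hA : A = ∅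
    · subst hA; simpa [polyLap, P] using hlap
    · simp [polyLap, P, Pi.single_eq_of_ne hA]
  refine ⟨smoothToL2 n (polySmooth n P), ⟨_, mem_eigenSmooth.2 ?_, rfl⟩, fun h0 => ?_⟩
  · rw [laplaceToCont_polySmooth hPh, hL, map_zero, map_zero, zero_add]
  · have h5 : polySmooth n P = 0 := smoothToL2_injective n (h0.trans (map_zero _).symm)
    have h6 : polyFun P (EuclideanSpace.single 0 1 : Euc n) = 0 :=
      DFunLike.congr_fun h5 (⟨EuclideanSpace.single 0 1, by simp⟩ : Sph n)
    rw [polyFun, Finset.sum_eq_single ∅] at h6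
    · simp only [P, Pi.single_eq_same, h4, one_smul] at h6
      exact (clBasis n).ne_zero ∅ h6
    · intro A _ hA
      simp [P, Pi.single_eq_of_ne hA, polyEval]
    · simp

end Eigen

end SphericalClifford

end

theorem mainTheorem7 (n : ℕ) (hn : 1 ≤ n) :
    -- the formulas for `Δ_s`
    (∀ f : Sph n → Cl n, ContMDiff (𝓡 n) 𝓘(ℝ, Cl n) 2 f →
      laplaceS f = diracBarS (diracS f + mulW f) ∧
      laplaceS f = diracS (diracBarS f + mulWBar f) ∧
      laplaceS f = -gammaS (gammaS f) + ((n : ℝ) - 1) • gammaS f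
        - ((n : ℝ) ^ 2 / 4 - (n : ℝ) / 2) • f ∧
      laplaceS f = -gammaBarS (gammaBarS f) + ((n : ℝ) - 1) • gammaBarS f
        - ((n : ℝ) ^ 2 / 4 - (n : ℝ) / 2) • f) ∧
    -- the action on `H_m`
    (∀ m : ℕ, ∀ h ∈ sphHarm n m,
      ContMDiff (𝓡 n) 𝓘(ℝ, Cl n) ∞ h ∧
      laplaceS h =
        (-(m : ℝ) ^ 2 - (m : ℝ) * ((n : ℝ) - 1) - ((n : ℝ) ^ 2 / 4 - (n : ℝ) / 2)) • h) ∧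
    -- the spectrum on `L²(Sⁿ, Cl_n)`
    (laplacePMap n).IsClosable ∧
    spectrumC (laplacePMap n).closure =
      {z : ℂ | ∃ m : ℕ, z = ((-(m : ℝ) ^ 2 - (m : ℝ) * ((n : ℝ) - 1)
        - ((n : ℝ) ^ 2 / 4 - (n : ℝ) / 2) : ℝ) : ℂ)} := by
  refine ⟨fun f hf => laplaceS_formulas hf, fun m h hh => laplaceS_sphHarm hh, ?_, ?_⟩
  · exact isClosable_of_eigenspaces (l := eigenval n) (iSup_eigenL2_dense hn)
      fun p hp k v hv => laplacePMap_symmetric hp k hv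
  · exact spectrumC_closure_of_eigenspaces (l := eigenval n) (iSup_eigenL2_dense hn)
      (fun p hp k v hv => laplacePMap_symmetric hp k hv) (fun k v hv => eigenL2_mem_graph k hv)
      (exists_ne_zero_mem_eigenL2 hn) (eigenval_injective hn) (tendsto_eigenval hn)
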